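/- Let $k$ be a commutative ring; all algebras and unadorned tensor products are over $k$. For a $k$-algebra $R$ let $\overline R$ be the opposite algebra, with $R\ni r\mapsto\overline r\in\overline R$ the obvious anti-isomorphism, and $R^e=R\otimes\overline R$, with $r=r\otimes 1$ and $\overline r=1\otimes\overline r$ in $R^e$. Left $R^e$-modules are the same as $R$-bimodules, and form a $k$-linear monoidal category with unit object $R$ and tensor product over $R$, that is, $M\diamond N=(M\otimes N)/\langle \overline r m\otimes n-m\otimes rn\rangle$, with $(r\overline s)(m\otimes n)=rm\otimes\overline s n$. A $\times_R$-bialgebra is a $k$-algebra $L$ with a $k$-algebra map $R^e\to L$, a comultiplication $\Delta\colon L\to L\times_RL$, $\Delta(\ell)=\ell_{(1)}\otimes\ell_{(2)}$, and a counit $\varepsilon\colon L\to\operatorname{End}_k(R)$, both of which are algebra maps compatible with the maps from $R^e$, such that $\Delta$ is coassociative in $L\diamond L\diamond L$ and $\overline{\varepsilon(\ell_{(2)})(1)}\,\ell_{(1)}=\ell=\varepsilon(\ell_{(1)})(1)\,\ell_{(2)}$ for all $\ell\in L$. Here $L\times_RL$ is the set of all $\sum x_i\otimes y_i\in L\diamond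 L$ with $\sum x_i\overline r\otimes y_i=\sum x_i\otimes y_ir$ for all $r\in R$, an algebra under factorwise multiplication, with $R^e\to L\times_R L$, $r\otimes\overline s\mapsto r\otimes\overline s$; and $R^e\to\operatorname{End}_k(R)$ is $r\otimes\overline s\mapsto(t\mapsto rts)$. The category of left $L$-modules is then monoidal, with tensor product $M\diamond N$ on which $\ell(m\otimes n)=\ell_{(1)}m\otimes\ell_{(2)}n$ and unit object $R$ on which $\ell t=\varepsilon(\ell)(t)$, and the underlying functor $\mathcal U$ from left $L$-modules to left $R^e$-modules is monoidal. The $\times_R$-bialgebra $L$ is a $\times_R$-Hopf algebra if the map $$\beta\colon L\otimes_{\overline R}L\to L\diamond L,\qquad \ell\otimes m\mapsto\ell_{(1)}\otimes\ell_{(2)}m,$$ is bijective, where $L\otimes_{\overline R}L=(L\otimes L)/\langle\ell\overline r\otimes m-\ell\otimes\overline rm\rangle$. Let $R$ and $S$ be $k$-algebras that are $\sqrt{\mathrm{Morita}}$-equivalent, through an equivalence $\mathcal F$ of $k$-linear monoidal categories from left $R^e$-modules to left $S^e$-modules. Let $L$ be a $\times_R$-bialgebra, and let $\widetilde L$ be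 the $\times_S$-bialgebra obtained from $L$ by base change along $\mathcal F$, that is, the $\times_S$-bialgebra, determined up to isomorphism, for which there is an equivalence $\mathcal G$ of monoidal categories from left $L$-modules to left $\widetilde L$-modules such that $\mathcal F\,\mathcal U\cong\widetilde{\mathcal U}\,\mathcal G$ as monoidal functors. Then $\widetilde L$ is a $\times_S$-Hopf algebra if and only if $L$ is a $\times_R$-Hopf algebra. -/

import Mathlib

open CategoryTheory TensorProduct MulOpposite
universe v u

noncomputable section

namespace QuantumGroupoid

section Env

variable (k : Type v) [CommRing k] (R : Type u) [Ring R] [Algebra k R]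

/-- The enveloping algebra `R ⊗ R̄` of a `k`-algebra `R`, where `R̄ = Rᵐᵒᵖ`. -/
abbrev Env := R ⊗[k] Rᵐᵒᵖ

variable {R}

/-- The element `r = r ⊗ 1` of `R ⊗ R̄`. -/
def inc (r : R) : Env k R := r ⊗ₜ[k] (1 : Rᵐᵒᵖ)

/-- The element `r̄ = 1 ⊗ r̄` of `R ⊗ R̄`. -/
def bar (r : R) : Env k R := (1 : R) ⊗ₜ[k] op r

lemma inc_mul_bar (r : R) (s : Rᵐᵒᵖ) : inc k r * bar k s.unop = r ⊗ₜ[k] s := by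
  simp [inc, bar]

lemma bar_mul_inc (r : R) (s : R) : bar k s * inc k r = inc k r * bar k s := by
  simp [inc, bar]

lemma inc_mul (r s : R) : inc k (r * s) = inc k r * inc k s := by simp [inc]

lemma bar_mul (r s : R) : bar k (r * s) = bar k s * bar k r := by simp [bar]

lemma inc_one : inc k (1 : R) = 1 := rfl

lemma bar_one : bar k (1 : R) = 1 := rfl

lemma inc_add (r s : R) : inc k (r + s) = inc k r + inc k s := add_tmul r s _

lemma bar_add (r s : R) : bar k (r + s) = bar k r + bar k s := tmul_add _ (op r) (op s)

lemma algebraMap_eq_inc (c : k) : algebraMap k (Env k R) c = inc k (algebraMap k R c) := by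
  rw [Algebra.TensorProduct.algebraMap_apply]; rfl

lemma algebraMap_eq_bar (c : k) : algebraMap k (Env k R) c = bar k (algebraMap k R c) := by
  rw [Algebra.TensorProduct.algebraMap_apply']; rfl

/-- Additive maps commuting with all `r` and all `r̄` are `R ⊗ R̄`-linear. -/
def linOf {M N : Type*} [AddCommGroup M] [AddCommGroup N] [Module (Env k R) M]
    [Module (Env k R) N] (f : M →+ N) (h₁ : ∀ (r : R) m, f (inc k r • m) = inc k r • f m)
    (h₂ : ∀ (r : R) m, f (bar k r • m) = bar k r • f m) : M →ₗ[Env k R] N :=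
  { f with
    map_smul' := fun a m => by
      dsimp only [ZeroHom.toFun_eq_coe, AddMonoidHom.toZeroHom_coe, RingHom.id_apply]
      induction a using TensorProduct.induction_on with
      | zero => 
        have hM : (0 : Env k R) • m = 0 := zero_smul (Env k R) m
        have hN : (0 : Env k R) • f m = 0 := zero_smul (Env k R) (f m)
        exact (congrArg f hM).trans ((map_zero f).trans hN.symm)
      | add x y hx hy => rw [add_smul, add_smul, map_add, hx, hy]
      | tmul r s => rw [← inc_mul_bar, mul_smul, mul_smul, h₁, h₂] }

end Env

section Diamond

variable (k : Type v) [CommRing k] (R : Type u) [Ring R] [Algebra k R]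
variable (M N : Type*) [AddCommGroup M] [Module (Env k R) M] [AddCommGroup N] [Module (Env k R) N]

/-- The tensor product `M ⋄ N` of two left `R ⊗ R̄`-modules, that is, of two `R`-bimodules over `R`:
the quotient of `M ⊗ N` (over `k`, which acts through `R ⊗ R̄`) by all `r̄ m ⊗ n - m ⊗ r n`. -/
def Diamond : Type _ :=
  letI : Module k M := Module.compHom M (algebraMap k (Env k R))
  letI : Module k N := Module.compHom N (algebraMap k (Env k R))
  (M ⊗[k] N) ⧸ AddSubgroup.closure
    {x : M ⊗[k] N | ∃ (r : R) (m : M) (n : N), x = (bar k r • m) ⊗ₜ n - m ⊗ₜ (inc k r • n)}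

instance : AddCommGroup (Diamond k R M N) :=
  letI : Module k M := Module.compHom M (algebraMap k (Env k R))
  letI : Module k N := Module.compHom N (algebraMap k (Env k R))
  QuotientAddGroup.Quotient.addCommGroup _

namespace Diamond

variable {M N}

/-- The class `m ⊗ n` in `M ⋄ N`. -/
def mk : M →+ N →+ Diamond k R M N :=
  letI : Module k M := Module.compHom M (algebraMap k (Env k R))
  letI : Module k N := Module.compHom N (algebraMap k (Env k R))
  AddMonoidHom.mk' (fun m => (QuotientAddGroup.mk' _).comp
      (TensorProduct.mk k M N m).toAddMonoidHom) fun m m' => by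
    ext n
    exact congrArg (QuotientAddGroup.mk' _) (TensorProduct.add_tmul m m' n)

variable {k R}

lemma mk_bar (r : R) (m : M) (n : N) : mk k R (bar k r • m) n = mk k R m (inc k r • n) :=
  let : Module k M := Module.compHom M (algebraMap k (Env k R))
  let : Module k N := Module.compHom N (algebraMap k (Env k R))
  (QuotientAddGroup.eq_iff_sub_mem).2 (AddSubgroup.subset_closure ⟨r, m, n, rfl⟩)

variable {P : Type*} [AddCommGroup P]

/-- The universal property of `M ⋄ N` with respect to balanced biadditive maps. -/
def lift (f : M →+ N →+ P) (hf : ∀ (r : R) m n, f (bar k r • m) n = f m (inc k r • n)) :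
    Diamond k R M N →+ P :=
  letI : Module k M := Module.compHom M (algebraMap k (Env k R))
  letI : Module k N := Module.compHom N (algebraMap k (Env k R))
  QuotientAddGroup.lift _
    (TensorProduct.liftAddHom f fun c m n => by
      change f (algebraMap k (Env k R) c • m) n = f m (algebraMap k (Env k R) c • n)
      rw [algebraMap_eq_bar, hf, ← algebraMap_eq_bar, ← algebraMap_eq_inc])
    ((AddSubgroup.closure_le _).2 (by
      rintro _ ⟨r, m, n, rfl⟩
      exact (map_sub _ _ _).trans (sub_eq_zero.2 (hf r m n))))

@[simp] lemma lift_mk (f : M →+ N →+ P)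
    (hf : ∀ (r : R) m n, f (bar k r • m) n = f m (inc k r • n)) (m : M) (n : N) :
    lift f hf (mk k R m n) = f m n := rfl

lemma induction {p : Diamond k R M N → Prop} (h0 : p 0) (hmk : ∀ m n, p (mk k R m n))
    (hadd : ∀ x y, p x → p y → p (x + y)) (x : Diamond k R M N) : p x := by
  let : Module k M := Module.compHom M (algebraMap k (Env k R))
  let : Module k N := Module.compHom N (algebraMap k (Env k R))
  obtain ⟨t, rfl⟩ := QuotientAddGroup.mk_surjective x
  induction t using TensorProduct.induction_on with
  | zero => exact h0
  | tmul m n => exact hmk m n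
  | add x y hx hy => exact hadd _ _ hx hy

lemma addHom_ext {f g : Diamond k R M N →+ P} (h : ∀ m n, f (mk k R m n) = g (mk k R m n)) :
    f = g := by
  ext x
  induction x using induction with
  | h0 => simp
  | hmk m n => exact h m n
  | hadd x y hx hy => rw [map_add, map_add, hx, hy]

variable {M' N' P' : Type*} [AddCommGroup M'] [AddCommGroup N'] [AddCommGroup P']

/-- Functoriality of `⋄` in additive maps compatible with the balancing. -/
def mapAdd [Module (Env k R) M'] [Module (Env k R) N'] (f : M →+ M') (g : N →+ N')
    (hf : ∀ (r : R) m, f (bar k r • m) = bar k r • f m)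
    (hg : ∀ (r : R) n, g (inc k r • n) = inc k r • g n) :
    Diamond k R M N →+ Diamond k R M' N' :=
  lift (((mk k R).compl₂ g).comp f) fun r m n => by
    simp [hf, hg, mk_bar]

@[simp] lemma mapAdd_mk [Module (Env k R) M'] [Module (Env k R) N'] (f : M →+ M') (g : N →+ N')
    (hf : ∀ (r : R) m, f (bar k r • m) = bar k r • f m)
    (hg : ∀ (r : R) n, g (inc k r • n) = inc k r • g n) (m : M) (n : N) :
    mapAdd f g hf hg (mk k R m n) = mk k R (f m) (g n) := rfl

/-- The action of `r` on `M ⋄ N`, through the left factor. -/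
def incAct : R →+ AddMonoid.End (Diamond k R M N) :=
  AddMonoidHom.mk' (fun r => mapAdd (DistribSMul.toAddMonoidHom M (inc k r)) (AddMonoidHom.id N)
    (fun s m => by
      change inc k r • bar k s • m = bar k s • inc k r • m
      rw [← mul_smul, ← mul_smul, bar_mul_inc]) fun _ _ => rfl) fun r s => by
    refine addHom_ext fun m n => ?_
    change mk k R (inc k (r + s) • m) n = mk k R (inc k r • m) n + mk k R (inc k s • m) n
    rw [inc_add, add_smul, map_add, AddMonoidHom.add_apply]

/-- The action of `s̄` on `M ⋄ N`, through the right factor. -/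
def barAct : Rᵐᵒᵖ →+ AddMonoid.End (Diamond k R M N) :=
  AddMonoidHom.mk' (fun r => mapAdd (AddMonoidHom.id M)
    (DistribSMul.toAddMonoidHom N (bar k r.unop)) (fun _ _ => rfl)
    (fun s m => by
      change bar k r.unop • inc k s • m = inc k s • bar k r.unop • m
      rw [← mul_smul, ← mul_smul, bar_mul_inc])) fun r s => by
    refine addHom_ext fun m n => ?_
    change mk k R m (bar k (r + s).unop • n) =
      mk k R m (bar k r.unop • n) + mk k R m (bar k s.unop • n)
    rw [show (r + s).unop = r.unop + s.unop from rfl, bar_add, add_smul, map_add]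

/-- The action of `R ⊗ R̄` on `M ⋄ N`. -/
def envAct : Env k R →+ AddMonoid.End (Diamond k R M N) :=
  TensorProduct.liftAddHom (AddMonoidHom.mul.compl₂ barAct |>.comp incAct) fun c r s => by
    refine addHom_ext fun m n => ?_
    change mk k R (inc k (c • r) • m) (bar k s.unop • n) =
      mk k R (inc k r • m) (bar k (c • s).unop • n)
    rw [unop_smul, Algebra.smul_def, Algebra.smul_def, Algebra.commutes c r, inc_mul, bar_mul,
      ← algebraMap_eq_inc, algebraMap_eq_bar, mul_smul, mul_smul, ← algebraMap_eq_bar,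
      algebraMap_eq_bar]
    rw [← mul_smul, ← bar_mul_inc, mul_smul, mk_bar, ← algebraMap_eq_inc, algebraMap_eq_bar,
      ← mul_smul, ← mul_smul, ← bar_mul, ← bar_mul, Algebra.commutes]

lemma envAct_tmul (r : R) (s : Rᵐᵒᵖ) (m : M) (n : N) :
    envAct (r ⊗ₜ s) (mk k R m n) = mk k R (inc k r • m) (bar k s.unop • n) := rfl

/-- `M ⋄ N` is an `R ⊗ R̄`-module through `r s̄ (m ⊗ n) = r m ⊗ s̄ n`. -/
instance : Module (Env k R) (Diamond k R M N) where
  smul a x := envAct a x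
  one_smul x := by
    change envAct ((1 : R) ⊗ₜ[k] (1 : Rᵐᵒᵖ)) x = x
    induction x using induction with
    | h0 => exact map_zero _
    | hmk m n => rw [envAct_tmul, inc_one, unop_one, bar_one, one_smul, one_smul]
    | hadd x y hx hy => rw [map_add, hx, hy]
  mul_smul a b x := by
    change envAct (a * b) x = envAct a (envAct b x)
    induction x using induction with
    | h0 => simp only [map_zero]
    | hadd x y hx hy => rw [map_add, hx, hy, map_add, map_add]
    | hmk m n =>
      induction a using TensorProduct.induction_on with
      | zero => simp
      | add x y hx hy => 
        rw [add_mul, map_add, map_add]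
        exact congrArg₂ (· + ·) hx hy
      | tmul r s =>
        induction b using TensorProduct.induction_on with
        | zero => simp
        | add x y hx hy => 
          rw [mul_add, map_add, map_add]
          exact (congrArg₂ (· + ·) hx hy).trans (map_add _ _ _).symm
        | tmul r' s' =>
          rw [Algebra.TensorProduct.tmul_mul_tmul, envAct_tmul, envAct_tmul, envAct_tmul, unop_mul,
            inc_mul, bar_mul, mul_smul, mul_smul]
  smul_zero a := map_zero _
  smul_add a x y := map_add _ _ _
  add_smul a b x := by
    change envAct (a + b) x = envAct a x + envAct b x
    rw [map_add]; rfl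
  zero_smul x := by
    change envAct 0 x = 0
    rw [map_zero]; rfl

lemma inc_smul_mk (r : R) (m : M) (n : N) :
    inc k r • mk k R m n = mk k R (inc k r • m) n := by
  change envAct (r ⊗ₜ 1) _ = _
  rw [envAct_tmul, unop_one, bar_one, one_smul]

lemma bar_smul_mk (r : R) (m : M) (n : N) :
    bar k r • mk k R m n = mk k R m (bar k r • n) := by
  change envAct (1 ⊗ₜ op r) _ = _
  rw [envAct_tmul, inc_one, one_smul, unop_op]

/-- Linear version of `lift`. -/
def liftLin [Module (Env k R) P] (f : M →+ N →+ P)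
    (hf : ∀ (r : R) m n, f (bar k r • m) n = f m (inc k r • n))
    (h₁ : ∀ (r : R) m n, f (inc k r • m) n = inc k r • f m n)
    (h₂ : ∀ (r : R) m n, f m (bar k r • n) = bar k r • f m n) :
    Diamond k R M N →ₗ[Env k R] P :=
  linOf k (lift f hf)
    (fun r x => by
      induction x using induction with
      | h0 => simp
      | hmk m n => rw [inc_smul_mk, lift_mk, lift_mk, h₁]
      | hadd x y hx hy => rw [smul_add, map_add, map_add, smul_add, hx, hy])
    (fun r x => by
      induction x using induction with
      | h0 => simp
      | hmk m n => rw [bar_smul_mk, lift_mk, lift_mk, h₂]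
      | hadd x y hx hy => rw [smul_add, map_add, map_add, smul_add, hx, hy])

@[simp] lemma liftLin_mk [Module (Env k R) P] (f : M →+ N →+ P)
    (hf : ∀ (r : R) m n, f (bar k r • m) n = f m (inc k r • n))
    (h₁ : ∀ (r : R) m n, f (inc k r • m) n = inc k r • f m n)
    (h₂ : ∀ (r : R) m n, f m (bar k r • n) = bar k r • f m n) (m : M) (n : N) :
    liftLin f hf h₁ h₂ (mk k R m n) = f m n := rfl

lemma lin_ext [Module (Env k R) P] {f g : Diamond k R M N →ₗ[Env k R] P}
    (h : ∀ m n, f (mk k R m n) = g (mk k R m n)) : f = g :=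
  LinearMap.toAddMonoidHom_injective (addHom_ext h)

/-- Functoriality of `⋄`. -/
def map [Module (Env k R) M'] [Module (Env k R) N'] (f : M →ₗ[Env k R] M')
    (g : N →ₗ[Env k R] N') : Diamond k R M N →ₗ[Env k R] Diamond k R M' N' :=
  liftLin (((mk k R).compl₂ g.toAddMonoidHom).comp f.toAddMonoidHom)
    (fun r m n => by simp [mk_bar]) (fun r m n => by simp [inc_smul_mk])
    (fun r m n => by simp [bar_smul_mk])

@[simp] lemma map_mk [Module (Env k R) M'] [Module (Env k R) N'] (f : M →ₗ[Env k R] M')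
    (g : N →ₗ[Env k R] N') (m : M) (n : N) :
    map f g (mk k R m n) = mk k R (f m) (g n) := rfl

variable (k R M N P)
variable [Module (Env k R) P]

/-- Auxiliary map `m ⊗ n ↦ (p ↦ m ⊗ (n ⊗ p))`. -/
def assocAux₁ : Diamond k R M N →+ P →+ Diamond k R M (Diamond k R N P) :=
  lift (AddMonoidHom.mk' (fun m => AddMonoidHom.mk'
      (fun n => (mk k R m).comp (mk k R n)) fun n n' => by
        ext p
        change mk k R m (mk k R (n + n') p) = mk k R m (mk k R n p) + mk k R m (mk k R n' p)
        rw [map_add, AddMonoidHom.add_apply, map_add]) fun m m' => by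
      ext n p
      change mk k R (m + m') (mk k R n p) = mk k R m (mk k R n p) + mk k R m' (mk k R n p)
      rw [map_add, AddMonoidHom.add_apply]) fun r m n => by
    ext p
    change mk k R (bar k r • m) (mk k R n p) = mk k R m (mk k R (inc k r • n) p)
    rw [mk_bar, inc_smul_mk]

lemma assocAux₁_mk (m : M) (n : N) (p : P) :
    assocAux₁ k R M N P (mk k R m n) p = mk k R m (mk k R n p) := rfl

/-- Auxiliary map `m ↦ (n ⊗ p ↦ (m ⊗ n) ⊗ p)`. -/
def assocAux₂ : M →+ Diamond k R N P →+ Diamond k R (Diamond k R M N) P :=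
  AddMonoidHom.mk' (fun m => lift (AddMonoidHom.mk' (fun n => mk k R (mk k R m n)) fun n n' => by
      rw [map_add, map_add]) fun r n p => by
      change mk k R (mk k R m (bar k r • n)) p = mk k R (mk k R m n) (inc k r • p)
      rw [← mk_bar, bar_smul_mk]) fun m m' => by
    refine addHom_ext fun n p => ?_
    change mk k R (mk k R (m + m') n) p = mk k R (mk k R m n) p + mk k R (mk k R m' n) p
    rw [map_add, AddMonoidHom.add_apply, map_add, AddMonoidHom.add_apply]

lemma assocAux₂_mk (m : M) (n : N) (p : P) :
    assocAux₂ k R M N P m (mk k R n p) = mk k R (mk k R m n) p := rfl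

/-- The map `(m ⊗ n) ⊗ p ↦ m ⊗ (n ⊗ p)`. -/
def assocHom : Diamond k R (Diamond k R M N) P →ₗ[Env k R] Diamond k R M (Diamond k R N P) :=
  liftLin (assocAux₁ k R M N P)
    (fun r x p => by
      induction x using induction with
      | h0 => simp only [smul_zero, map_zero, AddMonoidHom.zero_apply]
      | hadd x y hx hy =>
        rw [smul_add, map_add, map_add, AddMonoidHom.add_apply, AddMonoidHom.add_apply, hx, hy]
      | hmk m n => rw [bar_smul_mk, assocAux₁_mk, assocAux₁_mk, mk_bar])
    (fun r x p => by
      induction x using induction with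
      | h0 => simp only [smul_zero, map_zero, AddMonoidHom.zero_apply]
      | hadd x y hx hy =>
        rw [smul_add, map_add, map_add, AddMonoidHom.add_apply, AddMonoidHom.add_apply, hx, hy,
          smul_add]
      | hmk m n => rw [inc_smul_mk, assocAux₁_mk, assocAux₁_mk, inc_smul_mk])
    (fun r x p => by
      induction x using induction with
      | h0 => simp only [smul_zero, map_zero, AddMonoidHom.zero_apply]
      | hadd x y hx hy =>
        rw [map_add, AddMonoidHom.add_apply, AddMonoidHom.add_apply, hx, hy, smul_add]
      | hmk m n => rw [assocAux₁_mk, assocAux₁_mk, bar_smul_mk, bar_smul_mk])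

/-- The map `m ⊗ (n ⊗ p) ↦ (m ⊗ n) ⊗ p`. -/
def assocInv : Diamond k R M (Diamond k R N P) →ₗ[Env k R] Diamond k R (Diamond k R M N) P :=
  liftLin (assocAux₂ k R M N P)
    (fun r m x => by
      induction x using induction with
      | h0 => simp only [smul_zero, map_zero]
      | hadd x y hx hy => rw [smul_add, map_add, map_add, hx, hy]
      | hmk n p => rw [inc_smul_mk, assocAux₂_mk, assocAux₂_mk, mk_bar])
    (fun r m x => by
      induction x using induction with
      | h0 => simp only [smul_zero, map_zero]
      | hadd x y hx hy => rw [map_add, map_add, hx, hy, smul_add]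
      | hmk n p => rw [assocAux₂_mk, assocAux₂_mk, inc_smul_mk, inc_smul_mk])
    (fun r m x => by
      induction x using induction with
      | h0 => simp only [smul_zero, map_zero]
      | hadd x y hx hy => rw [smul_add, map_add, map_add, hx, hy, smul_add]
      | hmk n p => rw [bar_smul_mk, assocAux₂_mk, assocAux₂_mk, bar_smul_mk])

variable {k R M N P} in
/-- Linear maps out of `(M ⋄ N) ⋄ P` are determined on elements `(m ⊗ n) ⊗ p`. -/
lemma lin_ext₃ {Q : Type*} [AddCommGroup Q] [Module (Env k R) Q]
    {f g : Diamond k R (Diamond k R M N) P →ₗ[Env k R] Q}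
    (h : ∀ m n p, f (mk k R (mk k R m n) p) = g (mk k R (mk k R m n) p)) : f = g :=
  lin_ext fun x p => by
    induction x using induction with
    | h0 => simp only [map_zero, AddMonoidHom.zero_apply]
    | hadd x y hx hy => rw [map_add, AddMonoidHom.add_apply, map_add, map_add, hx, hy]
    | hmk m n => exact h m n p

variable {k R M N P} in
/-- Linear maps out of `M ⋄ (N ⋄ P)` are determined on elements `m ⊗ (n ⊗ p)`. -/
lemma lin_ext₃' {Q : Type*} [AddCommGroup Q] [Module (Env k R) Q]
    {f g : Diamond k R M (Diamond k R N P) →ₗ[Env k R] Q}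
    (h : ∀ m n p, f (mk k R m (mk k R n p)) = g (mk k R m (mk k R n p))) : f = g :=
  lin_ext fun m x => by
    induction x using induction with
    | h0 => simp only [map_zero]
    | hadd x y hx hy => rw [map_add, map_add, map_add, hx, hy]
    | hmk n p => exact h m n p

/-- The associativity isomorphism `(m ⊗ n) ⊗ p ↦ m ⊗ (n ⊗ p)`. -/
def assoc : Diamond k R (Diamond k R M N) P ≃ₗ[Env k R] Diamond k R M (Diamond k R N P) :=
  LinearEquiv.ofLinearMap (assocHom k R M N P) (assocInv k R M N P)
    (lin_ext₃' fun _ _ _ => rfl) (lin_ext₃ fun _ _ _ => rfl)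

@[simp] lemma assoc_mk (m : M) (n : N) (p : P) :
    assoc k R M N P (mk k R (mk k R m n) p) = mk k R m (mk k R n p) := rfl

end Diamond

/-- `R` as a left `R ⊗ R̄`-module: `(r ⊗ s̄) t = r t s`. -/
instance unitModule : Module (Env k R) R :=
  Module.compHom R (AlgHom.mulLeftRight k R).toRingHom

variable {R} in
lemma inc_smul_base (r t : R) : inc k r • t = r * t :=
  (AlgHom.mulLeftRight_apply k R r 1 t).trans (mul_one _)

variable {R} in
lemma bar_smul_base (r t : R) : bar k r • t = t * r := by
  refine (AlgHom.mulLeftRight_apply k R 1 (op r) t).trans ?_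
  rw [one_mul, unop_op]

namespace Diamond

/-- The left unit isomorphism `t ⊗ m ↦ t m`. -/
def lid : Diamond k R R M ≃ₗ[Env k R] M :=
  LinearEquiv.ofLinearMap
    (liftLin (AddMonoidHom.mk' (fun t => DistribSMul.toAddMonoidHom M (inc k t))
        fun s t => by ext m; simp [inc_add, add_smul])
      (fun r t m => by
        change inc k (bar k r • t) • m = inc k t • inc k r • m
        rw [bar_smul_base, inc_mul, mul_smul])
      (fun r t m => by
        change inc k (inc k r • t) • m = inc k r • inc k t • m
        rw [inc_smul_base, inc_mul, mul_smul])
      (fun r t m => by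
        change inc k t • bar k r • m = bar k r • inc k t • m
        rw [← mul_smul, ← mul_smul, bar_mul_inc]))
    (linOf k (mk k R (1 : R))
      (fun r m => by rw [inc_smul_mk, ← mk_bar, inc_smul_base, bar_smul_base, one_mul, mul_one])
      (fun r m => by rw [bar_smul_mk]))
    (by
      ext m
      change inc k (1 : R) • m = m
      rw [inc_one, one_smul])
    (lin_ext fun t m => by
      change mk k R 1 (inc k t • m) = mk k R t m
      rw [← mk_bar, bar_smul_base, one_mul])

@[simp] lemma lid_mk (t : R) (m : M) : lid k R M (mk k R t m) = inc k t • m := rfl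

/-- The right unit isomorphism `m ⊗ t ↦ t̄ m`. -/
def rid : Diamond k R M R ≃ₗ[Env k R] M :=
  LinearEquiv.ofLinearMap
    (liftLin (AddMonoidHom.flip (AddMonoidHom.mk'
        (fun t => DistribSMul.toAddMonoidHom M (bar k t))
        fun s t => by ext m; simp [bar_add, add_smul]))
      (fun r m t => by
        change bar k t • bar k r • m = bar k (inc k r • t) • m
        rw [inc_smul_base, bar_mul, mul_smul])
      (fun r m t => by
        change bar k t • inc k r • m = inc k r • bar k t • m
        rw [← mul_smul, ← mul_smul, bar_mul_inc])
      (fun r m t => by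
        change bar k (bar k r • t) • m = bar k r • bar k t • m
        rw [bar_smul_base, bar_mul, mul_smul]))
    (linOf k ((mk k R).flip (1 : R))
      (fun r m => by
        change mk k R (inc k r • m) 1 = inc k r • mk k R m 1
        rw [inc_smul_mk])
      (fun r m => by
        change mk k R (bar k r • m) 1 = bar k r • mk k R m 1
        rw [bar_smul_mk, mk_bar, inc_smul_base, bar_smul_base, one_mul, mul_one]))
    (by
      ext m
      change bar k (1 : R) • m = m
      rw [bar_one, one_smul])
    (lin_ext fun m t => by
      change mk k R (bar k t • m) 1 = mk k R m t
      rw [mk_bar, inc_smul_base, mul_one])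

@[simp] lemma rid_mk (m : M) (t : R) : rid k R M (mk k R m t) = bar k t • m := rfl

end Diamond

end Diamond

section Bialgebroid

variable (k : Type v) [CommRing k] (R : Type u) [Ring R] [Algebra k R]

/-- An `R ⊗ R̄`-ring: a `k`-algebra with a `k`-algebra map from `R ⊗ R̄`. -/
structure EnvRing where
  carrier : Type u
  [ring : Ring carrier]
  [algebra : Algebra k carrier]
  unit : Env k R →ₐ[k] carrier

attribute [instance] EnvRing.ring EnvRing.algebra

instance : CoeSort (EnvRing k R) (Type u) := ⟨EnvRing.carrier⟩

namespace EnvRing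

variable {k R} (L : EnvRing k R)

instance : Module (Env k R) L := Module.compHom L L.unit.toRingHom

lemma smul_eq (a : Env k R) (x : L) : a • x = L.unit a * x := rfl

instance : IsScalarTower (Env k R) L L := ⟨fun a x y => mul_assoc (L.unit a) x y⟩

/-- Right multiplication by `y` as a left `R ⊗ R̄`-linear map. -/
def mulRight (y : L) : L →ₗ[Env k R] L where
  toFun x := x * y
  map_add' x x' := add_mul x x' y
  map_smul' a x := mul_assoc (L.unit a) x y

@[simp] lemma mulRight_apply (x y : L) : L.mulRight y x = x * y := rfl

/-- The product `L ×_R L`: the elements `∑ xᵢ ⊗ yᵢ` of `L ⋄ L` with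
`∑ xᵢ r̄ ⊗ yᵢ = ∑ xᵢ ⊗ yᵢ r` for all `r` in `R`. -/
def takeuchi : AddSubgroup (Diamond k R L L) where
  carrier := {t | ∀ r : R, Diamond.map (L.mulRight (L.unit (bar k r))) LinearMap.id t =
    Diamond.map LinearMap.id (L.mulRight (L.unit (inc k r))) t}
  add_mem' hs ht r := by rw [map_add, map_add, hs r, ht r]
  zero_mem' r := by rw [map_zero, map_zero]
  neg_mem' ht r := by rw [map_neg, map_neg, ht r]

section Action

variable {M N : Type*} [AddCommGroup M] [Module (Env k R) M] [Module L M]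
  [IsScalarTower (Env k R) L M] [AddCommGroup N] [Module (Env k R) N] [Module L N]
  [IsScalarTower (Env k R) L N]

lemma unit_smul (a : Env k R) (m : M) : L.unit a • m = a • m := by
  rw [← mul_one (L.unit a), ← smul_eq, smul_assoc, one_smul]

variable (M N) in
/-- For `t = ∑ xᵢ ⊗ yᵢ` in `L ⋄ L`, the biadditive map `(m, n) ↦ ∑ xᵢ m ⊗ yᵢ n`. -/
def act : Diamond k R L L →+ M →+ N →+ Diamond k R M N :=
  Diamond.lift
    (AddMonoidHom.mk' (fun x => AddMonoidHom.mk' (fun y =>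
        ((Diamond.mk k R).compl₂ (DistribSMul.toAddMonoidHom N y)).comp
          (DistribSMul.toAddMonoidHom M x))
        fun y y' => by
          ext m n
          change Diamond.mk k R (x • m) ((y + y') • n) =
            Diamond.mk k R (x • m) (y • n) + Diamond.mk k R (x • m) (y' • n)
          rw [add_smul, map_add])
      fun x x' => by
        ext y m n
        change Diamond.mk k R ((x + x') • m) (y • n) =
          Diamond.mk k R (x • m) (y • n) + Diamond.mk k R (x' • m) (y • n)
        rw [add_smul, map_add, AddMonoidHom.add_apply])
    fun r x y => by
      ext m n
      change Diamond.mk k R ((bar k r • x) • m) (y • n) =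
        Diamond.mk k R (x • m) ((inc k r • y) • n)
      rw [smul_assoc, smul_assoc, Diamond.mk_bar]

@[simp] lemma act_mk (x y : L) (m : M) (n : N) :
    L.act M N (Diamond.mk k R x y) m n = Diamond.mk k R (x • m) (y • n) := rfl

lemma act_balanced {t : Diamond k R L L} (ht : t ∈ L.takeuchi) (r : R) (m : M) (n : N) :
    L.act M N t (bar k r • m) n = L.act M N t m (inc k r • n) := by
  have h₁ : ∀ s, L.act M N s (bar k r • m) n =
      L.act M N (Diamond.map (L.mulRight (L.unit (bar k r))) LinearMap.id s) m n := fun s => by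
    induction s using Diamond.induction with
    | h0 => simp only [map_zero, AddMonoidHom.zero_apply]
    | hadd x y hx hy => simp only [map_add, AddMonoidHom.add_apply, hx, hy]
    | hmk x y =>
      rw [Diamond.map_mk, act_mk, act_mk, mulRight_apply, mul_smul, unit_smul, LinearMap.id_apply]
  have h₂ : ∀ s, L.act M N s m (inc k r • n) =
      L.act M N (Diamond.map LinearMap.id (L.mulRight (L.unit (inc k r))) s) m n := fun s => by
    induction s using Diamond.induction with
    | h0 => simp only [map_zero, AddMonoidHom.zero_apply]
    | hadd x y hx hy => simp only [map_add, AddMonoidHom.add_apply, hx, hy]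
    | hmk x y =>
      rw [Diamond.map_mk, act_mk, act_mk, mulRight_apply, mul_smul, unit_smul, LinearMap.id_apply]
  rw [h₁, h₂, ht r]

variable (M N) in
/-- The action `(∑ xᵢ ⊗ yᵢ) (m ⊗ n) = ∑ xᵢ m ⊗ yᵢ n` of `L ×_R L` on `M ⋄ N`. -/
def takeuchiAct : L.takeuchi →+ AddMonoid.End (Diamond k R M N) :=
  AddMonoidHom.mk' (fun t => Diamond.lift (L.act M N t) fun r m n => L.act_balanced t.2 r m n)
    fun s t => Diamond.addHom_ext fun m n => by
      change L.act M N (s + t) m n = L.act M N s m n + L.act M N t m n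
      rw [map_add]; rfl

@[simp] lemma takeuchiAct_mk (t : L.takeuchi) (m : M) (n : N) :
    L.takeuchiAct M N t (Diamond.mk k R m n) = L.act M N t m n := rfl

lemma takeuchiAct_act (t : L.takeuchi) (s : Diamond k R L L) (m : M) (n : N) :
    L.takeuchiAct M N t (L.act M N s m n) = L.act M N (L.takeuchiAct L L t s) m n := by
  induction s using Diamond.induction with
  | h0 => simp only [map_zero, AddMonoidHom.zero_apply]
  | hadd x y hx hy => simp only [map_add, AddMonoidHom.add_apply, hx, hy]
  | hmk x y =>
    rw [act_mk, takeuchiAct_mk, takeuchiAct_mk]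
    generalize (t : Diamond k R L L) = t'
    induction t' using Diamond.induction with
    | h0 => simp only [map_zero, AddMonoidHom.zero_apply]
    | hadd x y hx hy => simp only [map_add, AddMonoidHom.add_apply, hx, hy]
    | hmk x' y' => rw [act_mk, act_mk, act_mk, smul_assoc, smul_assoc]

end Action

lemma takeuchiAct_mem (s t : L.takeuchi) : L.takeuchiAct L L s t ∈ L.takeuchi := by
  intro r
  have h₁ : ∀ t', Diamond.map (L.mulRight (L.unit (bar k r))) LinearMap.id
      (L.takeuchiAct L L s t') = L.takeuchiAct L L s
        (Diamond.map (L.mulRight (L.unit (bar k r))) LinearMap.id t') := fun t' => by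
    induction t' using Diamond.induction with
    | h0 => simp only [map_zero]
    | hadd x y hx hy => simp only [map_add, hx, hy]
    | hmk x y =>
      rw [Diamond.map_mk, takeuchiAct_mk, takeuchiAct_mk]
      generalize (s : Diamond k R L L) = s'
      induction s' using Diamond.induction with
      | h0 => simp only [map_zero, AddMonoidHom.zero_apply]
      | hadd x y hx hy => simp only [map_add, AddMonoidHom.add_apply, hx, hy]
      | hmk x' y' =>
        rw [act_mk, act_mk, Diamond.map_mk, mulRight_apply, mulRight_apply, smul_eq_mul,
          smul_eq_mul, mul_assoc]
        rfl
  have h₂ : ∀ t', Diamond.map LinearMap.id (L.mulRight (L.unit (inc k r)))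
      (L.takeuchiAct L L s t') = L.takeuchiAct L L s
        (Diamond.map LinearMap.id (L.mulRight (L.unit (inc k r))) t') := fun t' => by
    induction t' using Diamond.induction with
    | h0 => simp only [map_zero]
    | hadd x y hx hy => simp only [map_add, hx, hy]
    | hmk x y =>
      rw [Diamond.map_mk, takeuchiAct_mk, takeuchiAct_mk]
      generalize (s : Diamond k R L L) = s'
      induction s' using Diamond.induction with
      | h0 => simp only [map_zero, AddMonoidHom.zero_apply]
      | hadd x y hx hy => simp only [map_add, AddMonoidHom.add_apply, hx, hy]
      | hmk x' y' =>
        rw [act_mk, act_mk, Diamond.map_mk, mulRight_apply, mulRight_apply, smul_eq_mul,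
          smul_eq_mul, mul_assoc]
        rfl
  rw [h₁, h₂, t.2 r]

lemma one_mem : Diamond.mk k R (1 : L) (1 : L) ∈ L.takeuchi := fun r => by
  rw [Diamond.map_mk, Diamond.map_mk, mulRight_apply, mulRight_apply, one_mul, one_mul,
    LinearMap.id_apply, ← mul_one (L.unit _), ← mul_one (L.unit (inc k r)), ← smul_eq, ← smul_eq,
    Diamond.mk_bar]

lemma takeuchiAct_one {M N : Type*} [AddCommGroup M] [Module (Env k R) M] [Module L M]
    [IsScalarTower (Env k R) L M] [AddCommGroup N] [Module (Env k R) N] [Module L N]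
    [IsScalarTower (Env k R) L N] (x : Diamond k R M N) :
    L.takeuchiAct M N ⟨_, L.one_mem⟩ x = x := by
  induction x using Diamond.induction with
  | h0 => rw [map_zero]
  | hadd x y hx hy => rw [map_add, hx, hy]
  | hmk m n => rw [takeuchiAct_mk, act_mk, one_smul, one_smul]

lemma takeuchiAct_takeuchiAct {M N : Type*} [AddCommGroup M] [Module (Env k R) M] [Module L M]
    [IsScalarTower (Env k R) L M] [AddCommGroup N] [Module (Env k R) N] [Module L N]
    [IsScalarTower (Env k R) L N] (s t : L.takeuchi) (x : Diamond k R M N) :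
    L.takeuchiAct M N ⟨_, L.takeuchiAct_mem s t⟩ x =
      L.takeuchiAct M N s (L.takeuchiAct M N t x) := by
  induction x using Diamond.induction with
  | h0 => simp only [map_zero]
  | hadd x y hx hy => simp only [map_add, hx, hy]
  | hmk m n => rw [takeuchiAct_mk, takeuchiAct_mk, takeuchiAct_act]

/-- `L ×_R L` is a ring with `(∑ xᵢ ⊗ yᵢ) (∑ xⱼ' ⊗ yⱼ') = ∑ xᵢ xⱼ' ⊗ yᵢ yⱼ'`. -/
instance : Ring L.takeuchi :=
  { (inferInstance : AddCommGroup L.takeuchi) with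
    mul := fun s t => ⟨L.takeuchiAct L L s t, L.takeuchiAct_mem s t⟩
    one := ⟨Diamond.mk k R 1 1, L.one_mem⟩
    mul_assoc := fun s t r => Subtype.ext (L.takeuchiAct_takeuchiAct s t (r : Diamond k R L L))
    one_mul := fun t => Subtype.ext (L.takeuchiAct_one (t : Diamond k R L L))
    mul_one := fun t => Subtype.ext (by
      change L.act L L t 1 1 = t
      generalize (t : Diamond k R L L) = t'
      induction t' using Diamond.induction with
      | h0 => simp only [map_zero, AddMonoidHom.zero_apply]
      | hadd x y hx hy => simp only [map_add, AddMonoidHom.add_apply, hx, hy]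
      | hmk x y => rw [act_mk, smul_eq_mul, smul_eq_mul, mul_one, mul_one])
    left_distrib := fun s t r => Subtype.ext (map_add (L.takeuchiAct L L s) _ _)
    right_distrib := fun s t r => Subtype.ext (by
      change L.takeuchiAct L L (s + t) r = _
      rw [map_add]; rfl)
    zero_mul := fun t => Subtype.ext (by
      change L.takeuchiAct L L 0 t = _
      rw [map_zero]; rfl)
    mul_zero := fun t => Subtype.ext (map_zero (L.takeuchiAct L L t)) }

lemma coe_mul (s t : L.takeuchi) : ((s * t : L.takeuchi) : Diamond k R L L) =
    L.takeuchiAct L L s t := rfl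

lemma coe_one : ((1 : L.takeuchi) : Diamond k R L L) = Diamond.mk k R 1 1 := rfl

end EnvRing

/-- An `R ⊗ R̄`-ring `L` with `R ⊗ R̄`-ring maps `Δ : L → L ×_R L` and `ε : L → End(R)`; here
`End(R)` is an `R ⊗ R̄`-ring through `r ⊗ s̄ ↦ (t ↦ r t s)`, and `L ×_R L` through
`r ⊗ s̄ ↦ r ⊗ s̄`. -/
structure PreTakeuchiBialgebra where
  toEnvRing : EnvRing k R
  comul : toEnvRing →+* toEnvRing.takeuchi
  comul_unit : ∀ (r : R) (s : Rᵐᵒᵖ), (comul (toEnvRing.unit (r ⊗ₜ s)) : Diamond k R _ _) =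
    Diamond.mk k R (toEnvRing.unit (r ⊗ₜ 1)) (toEnvRing.unit (1 ⊗ₜ s))
  counit : toEnvRing →ₐ[k] Module.End k R
  counit_unit : ∀ a, counit (toEnvRing.unit a) = AlgHom.mulLeftRight k R a

instance : CoeSort (PreTakeuchiBialgebra k R) (Type u) := ⟨fun L => L.toEnvRing⟩

namespace PreTakeuchiBialgebra

variable {k R} (L : PreTakeuchiBialgebra k R)

section

variable (M N : Type*) [AddCommGroup M] [Module (Env k R) M] [Module L M]
  [IsScalarTower (Env k R) L M] [AddCommGroup N] [Module (Env k R) N] [Module L N]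
  [IsScalarTower (Env k R) L N]

/-- The `L`-module structure `ℓ (m ⊗ n) = ∑ ℓ₁ m ⊗ ℓ₂ n` on `M ⋄ N`. -/
instance diamondModule : Module L (Diamond k R M N) where
  smul x t := L.toEnvRing.takeuchiAct M N (L.comul x) t
  one_smul t := by
    change L.toEnvRing.takeuchiAct M N (L.comul 1) t = t
    rw [map_one]
    exact L.toEnvRing.takeuchiAct_one t
  mul_smul x y t := by
    change L.toEnvRing.takeuchiAct M N (L.comul (x * y)) t = _
    rw [map_mul]
    exact L.toEnvRing.takeuchiAct_takeuchiAct _ _ t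
  smul_zero _ := map_zero _
  smul_add _ := map_add _
  add_smul x y t := by
    change L.toEnvRing.takeuchiAct M N (L.comul (x + y)) t = _
    rw [map_add, map_add]
    rfl
  zero_smul t := by
    change L.toEnvRing.takeuchiAct M N (L.comul 0) t = _
    rw [map_zero, map_zero]
    rfl

variable {M N}

lemma smul_mk (x : L) (m : M) (n : N) :
    x • Diamond.mk k R m n = L.toEnvRing.act M N (L.comul x) m n := rfl

lemma unit_smul_diamond (a : Env k R) (t : Diamond k R M N) :
    L.toEnvRing.unit a • t = a • t := by
  induction t using Diamond.induction with
  | h0 => rw [smul_zero, smul_zero]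
  | hadd x y hx hy => rw [smul_add, smul_add, hx, hy]
  | hmk m n =>
    induction a using TensorProduct.induction_on with
    | zero =>
      have h : L.toEnvRing.unit (0 : Env k R) = 0 := map_zero _
      have h' : (0 : Env k R) • Diamond.mk k R m n = 0 :=
        zero_smul (Env k R) (Diamond.mk k R m n)
      have h'' : (0 : L) • Diamond.mk k R m n = 0 := zero_smul L _
      exact (congrArg (· • Diamond.mk k R m n) h).trans (h''.trans h'.symm)
    | add x y hx hy => rw [map_add, add_smul, add_smul, hx, hy]
    | tmul r s =>
      rw [smul_mk, comul_unit, EnvRing.act_mk, EnvRing.unit_smul, EnvRing.unit_smul]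
      exact (Diamond.envAct_tmul r s m n).symm

instance : IsScalarTower (Env k R) L (Diamond k R M N) :=
  ⟨fun a x t => by rw [EnvRing.smul_eq, mul_smul, unit_smul_diamond]⟩

end

/-- The comultiplication as a map `L → L ⋄ L` of left `R ⊗ R̄`-modules. -/
def comulLin : L →ₗ[Env k R] Diamond k R L L where
  toFun x := L.comul x
  map_add' x y := by rw [map_add]; rfl
  map_smul' a x := by
    rw [EnvRing.smul_eq, map_mul, EnvRing.coe_mul]
    exact L.unit_smul_diamond a _

/-- The map `ℓ ↦ ε(ℓ)(1)` as a map `L → R` of left `R ⊗ R̄`-modules. -/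
def counitLin : L →ₗ[Env k R] R where
  toFun x := L.counit x 1
  map_add' x y := by rw [map_add]; rfl
  map_smul' a x := by
    rw [EnvRing.smul_eq, map_mul, counit_unit]; rfl

end PreTakeuchiBialgebra

/-- A `×_R`-bialgebra: coassociativity is an equation in `L ⋄ (L ⋄ L)`, and the counit axioms
read `∑ \overline{ε(ℓ₂)(1)} ℓ₁ = ℓ = ∑ ε(ℓ₁)(1) ℓ₂`. -/
structure TakeuchiBialgebra extends PreTakeuchiBialgebra k R where
  coassoc : ∀ x : toPreTakeuchiBialgebra,
    Diamond.assoc k R _ _ _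
        (Diamond.map toPreTakeuchiBialgebra.comulLin LinearMap.id (toPreTakeuchiBialgebra.comulLin x)) =
      Diamond.map LinearMap.id toPreTakeuchiBialgebra.comulLin (toPreTakeuchiBialgebra.comulLin x)
  rid_counit : ∀ x : toPreTakeuchiBialgebra,
    Diamond.rid k R _
      (Diamond.map LinearMap.id toPreTakeuchiBialgebra.counitLin (toPreTakeuchiBialgebra.comulLin x)) = x
  lid_counit : ∀ x : toPreTakeuchiBialgebra,
    Diamond.lid k R _
      (Diamond.map toPreTakeuchiBialgebra.counitLin LinearMap.id (toPreTakeuchiBialgebra.comulLin x)) = x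

end Bialgebroid

section Categories

variable (k : Type v) [CommRing k] (R : Type u) [Ring R] [Algebra k R]

/-- The category of left `R ⊗ R̄`-modules, that is, of `R`-bimodules over `k`. -/
abbrev BimodCat := ModuleCat.{u} (Env k R)

instance bimodStruct : MonoidalCategoryStruct (BimodCat k R) where
  tensorObj M N := ModuleCat.of _ (Diamond k R M N)
  whiskerLeft M _ _ g := ModuleCat.ofHom (Diamond.map LinearMap.id g.hom)
  whiskerRight f N := ModuleCat.ofHom (Diamond.map f.hom LinearMap.id)
  tensorHom f g := ModuleCat.ofHom (Diamond.map f.hom g.hom)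
  tensorUnit := ModuleCat.of _ R
  associator M N P := (Diamond.assoc k R M N P).toModuleIso
  leftUnitor M := (Diamond.lid k R M).toModuleIso
  rightUnitor M := (Diamond.rid k R M).toModuleIso

open MonoidalCategory in
lemma BimodCat.hom_ext {M N P : BimodCat k R} {f g : M ⊗ N ⟶ P}
    (h : ∀ m n, f.hom (Diamond.mk k R m n) = g.hom (Diamond.mk k R m n)) : f = g :=
  ModuleCat.hom_ext (Diamond.lin_ext h)

open MonoidalCategory in
lemma BimodCat.hom_ext₃ {M N P Q : BimodCat k R} {f g : (M ⊗ N) ⊗ P ⟶ Q}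
    (h : ∀ m n p, f.hom (Diamond.mk k R (Diamond.mk k R m n) p) =
      g.hom (Diamond.mk k R (Diamond.mk k R m n) p)) : f = g :=
  ModuleCat.hom_ext (Diamond.lin_ext₃ h)

open MonoidalCategory in
lemma BimodCat.hom_ext₄ {M N P Q V : BimodCat k R} {f g : ((M ⊗ N) ⊗ P) ⊗ Q ⟶ V}
    (h : ∀ m n p q, f.hom (Diamond.mk k R (Diamond.mk k R (Diamond.mk k R m n) p) q) =
      g.hom (Diamond.mk k R (Diamond.mk k R (Diamond.mk k R m n) p) q)) : f = g :=
  ModuleCat.hom_ext (Diamond.lin_ext₃ fun x p q => by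
    refine Diamond.induction (p := fun x => f.hom (Diamond.mk k R (Diamond.mk k R x p) q) =
      g.hom (Diamond.mk k R (Diamond.mk k R x p) q)) ?_ (fun m n => h m n p q) ?_ x
    · simp only [map_zero, AddMonoidHom.zero_apply]
    · intro x y hx hy
      simp only [map_add, AddMonoidHom.add_apply, hx, hy])

/-- The monoidal category of `R`-bimodules, with tensor product over `R` and unit `R`. -/
instance bimodMonoidal : MonoidalCategory (BimodCat k R) where
  tensorHom_def _ _ := BimodCat.hom_ext k R fun _ _ => rfl
  id_tensorHom_id _ _ := BimodCat.hom_ext k R fun _ _ => rfl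
  tensorHom_comp_tensorHom _ _ _ _ := BimodCat.hom_ext k R fun _ _ => rfl
  whiskerLeft_id _ _ := BimodCat.hom_ext k R fun _ _ => rfl
  id_whiskerRight _ _ := BimodCat.hom_ext k R fun _ _ => rfl
  associator_naturality _ _ _ := BimodCat.hom_ext₃ k R fun _ _ _ => rfl
  leftUnitor_naturality f := BimodCat.hom_ext k R fun t m =>
    (f.hom.map_smul (inc k t) m).symm
  rightUnitor_naturality f := BimodCat.hom_ext k R fun m t =>
    (f.hom.map_smul (bar k t) m).symm
  pentagon _ _ _ _ := BimodCat.hom_ext₄ k R fun _ _ _ _ => rfl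
  triangle M N := BimodCat.hom_ext₃ k R fun m t n =>
    (Diamond.mk_bar t m n).symm

end Categories

section RepCategories

variable {k : Type v} [CommRing k] {R : Type u} [Ring R] [Algebra k R]

instance : CoeSort (TakeuchiBialgebra k R) (Type u) := ⟨fun L => L.toEnvRing⟩

namespace TakeuchiBialgebra

variable (L : TakeuchiBialgebra k R)

/-- The category of left modules over (the underlying algebra of) `L`. -/
abbrev Rep := ModuleCat.{u} L

/-- The underlying functor from `L`-modules to `R ⊗ R̄`-modules. -/
abbrev forget : L.Rep ⥤ BimodCat k R := ModuleCat.restrictScalars L.toEnvRing.unit.toRingHom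

instance (M : L.Rep) : IsScalarTower (Env k R) L (L.forget.obj M) :=
  ⟨fun a x m => mul_smul (L.toEnvRing.unit a) x (show M from m)⟩

/-- An `R ⊗ R̄`-linear map commuting with the action of `L` is a morphism of `L`-modules. -/
def homMk {M N : L.Rep} (f : L.forget.obj M ⟶ L.forget.obj N)
    (hf : ∀ (x : L) (m : L.forget.obj M), f.hom (x • m) = x • f.hom m) : M ⟶ N :=
  ModuleCat.ofHom
    { toFun := f.hom
      map_add' := f.hom.map_add
      map_smul' := hf }

/-- Isomorphisms of `L`-modules from isomorphisms of `R ⊗ R̄`-modules. -/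
def isoMk {M N : L.Rep} (f : L.forget.obj M ≅ L.forget.obj N)
    (hf : ∀ (x : L) (m : L.forget.obj M), f.hom.hom (x • m) = x • f.hom.hom m) : M ≅ N where
  hom := L.homMk f.hom hf
  inv := L.homMk f.inv fun x n => by
    have h : ∀ n, f.hom.hom (f.inv.hom n) = n := fun n =>
      congrArg (fun g => g.hom n) f.inv_hom_id
    have h' : ∀ m, f.inv.hom (f.hom.hom m) = m := fun m =>
      congrArg (fun g => g.hom m) f.hom_inv_id
    rw [← h' (x • f.inv.hom n), hf, h]
  hom_inv_id := L.forget.map_injective f.hom_inv_id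
  inv_hom_id := L.forget.map_injective f.inv_hom_id

/-- The `L`-module `M ⋄ N` with `ℓ (m ⊗ n) = ∑ ℓ₁ m ⊗ ℓ₂ n`. -/
def tensor (M N : L.Rep) : L.Rep :=
  ModuleCat.of L (Diamond k R (L.forget.obj M) (L.forget.obj N))

/-- The `L`-module `R` with `ℓ t = ε(ℓ)(t)`. -/
def unitObj : L.Rep :=
  letI : Module L R := Module.compHom R L.counit.toRingHom
  ModuleCat.of L R

open MonoidalCategory

/-- The identity of `M ⋄ N` as an isomorphism of `R ⊗ R̄`-modules. -/
def tensorEquiv (M N : L.Rep) :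
    Diamond k R (L.forget.obj M) (L.forget.obj N) ≃ₗ[Env k R] L.forget.obj (L.tensor M N) where
  toFun t := t
  invFun t := t
  map_add' _ _ := rfl
  map_smul' a t := (L.unit_smul_diamond a t).symm
  left_inv _ := rfl
  right_inv _ := rfl

/-- The identity of `R` as an isomorphism of `R ⊗ R̄`-modules. -/
def unitEquiv : R ≃ₗ[Env k R] L.forget.obj L.unitObj where
  toFun t := t
  invFun t := t
  map_add' _ _ := rfl
  map_smul' a t := (congrArg (fun f : Module.End k R => f t) (L.counit_unit a)).symm
  left_inv _ := rfl
  right_inv _ := rfl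

/-- The identity of `M ⋄ N` as an isomorphism in the category of `R ⊗ R̄`-modules. -/
def tensorIso (M N : L.Rep) :
    L.forget.obj M ⊗ L.forget.obj N ≅ L.forget.obj (L.tensor M N) :=
  (L.tensorEquiv M N).toModuleIso

/-- The identity of `R` as an isomorphism in the category of `R ⊗ R̄`-modules. -/
def unitIso : 𝟙_ (BimodCat k R) ≅ L.forget.obj L.unitObj :=
  L.unitEquiv.toModuleIso

lemma map_smul_tensor {M₁ M₂ N₁ N₂ : L.Rep} (f : M₁ ⟶ M₂) (g : N₁ ⟶ N₂) (x : L)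
    (t : Diamond k R (L.forget.obj M₁) (L.forget.obj N₁)) :
    Diamond.map (L.forget.map f).hom (L.forget.map g).hom (x • t) =
      x • Diamond.map (L.forget.map f).hom (L.forget.map g).hom t := by
  induction t using Diamond.induction with
  | h0 => simp only [smul_zero, map_zero]
  | hadd s t hs ht => simp only [smul_add, map_add, hs, ht]
  | hmk m n =>
    rw [Diamond.map_mk, PreTakeuchiBialgebra.smul_mk, PreTakeuchiBialgebra.smul_mk]
    generalize (L.comul x : Diamond k R L L) = D
    induction D using Diamond.induction with
    | h0 => simp only [map_zero, AddMonoidHom.zero_apply]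
    | hadd s t hs ht => simp only [map_add, AddMonoidHom.add_apply, hs, ht]
    | hmk y z =>
      rw [EnvRing.act_mk, EnvRing.act_mk, Diamond.map_mk]
      exact congrArg₂ (fun a b => Diamond.mk k R a b) (f.hom.map_smul y m) (g.hom.map_smul z n)

lemma act_inc_smul {N P : L.Rep} (r : R) (w : Diamond k R L L) (n : L.forget.obj N)
    (p : L.forget.obj P) :
    L.toEnvRing.act (L.forget.obj N) (L.forget.obj P) (inc k r • w) n p =
      inc k r • L.toEnvRing.act (L.forget.obj N) (L.forget.obj P) w n p := by
  induction w using Diamond.induction with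
  | h0 => simp only [smul_zero, map_zero, AddMonoidHom.zero_apply]
  | hadd s t hs ht => simp only [smul_add, map_add, AddMonoidHom.add_apply, hs, ht]
  | hmk y z =>
    rw [Diamond.inc_smul_mk, EnvRing.act_mk, EnvRing.act_mk, Diamond.inc_smul_mk, smul_assoc]

/-- The additive map `x ⊗ (y ⊗ z) ↦ x m ⊗ (y n ⊗ z p)`. -/
def act₃ {M N P : L.Rep} (m : L.forget.obj M) (n : L.forget.obj N) (p : L.forget.obj P) :
    Diamond k R L (Diamond k R L L) →+
      Diamond k R (L.forget.obj M) (L.forget.obj (L.tensor N P)) :=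
  Diamond.lift
    (AddMonoidHom.mk' (fun x => AddMonoidHom.mk'
        (fun w => Diamond.mk k R (x • m) ((L.tensorIso N P).hom.hom
          (L.toEnvRing.act (L.forget.obj N) (L.forget.obj P) w n p)))
        fun w w' => by simp only [map_add, AddMonoidHom.add_apply])
      fun x x' => by
        ext w
        change Diamond.mk k R ((x + x') • m) _ =
          Diamond.mk k R (x • m) _ + Diamond.mk k R (x' • m) _
        rw [add_smul, map_add, AddMonoidHom.add_apply])
    fun r x w => by
      change Diamond.mk k R ((bar k r • x) • m) _ = Diamond.mk k R (x • m)
        ((L.tensorIso N P).hom.hom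
          (L.toEnvRing.act (L.forget.obj N) (L.forget.obj P) (inc k r • w) n p))
      rw [smul_assoc, Diamond.mk_bar, act_inc_smul]
      exact congrArg _ (((L.tensorIso N P).hom.hom.map_smul (inc k r) _).symm)

/-- The associativity isomorphism of the underlying `R ⊗ R̄`-modules. -/
def assocIso (M N P : L.Rep) :
    L.forget.obj (L.tensor (L.tensor M N) P) ≅ L.forget.obj (L.tensor M (L.tensor N P)) :=
  ((L.tensorIso _ _).symm ≪≫ ((L.tensorIso _ _).symm ⊗ᵢ .refl _)) ≪≫
    α_ (L.forget.obj M) (L.forget.obj N) (L.forget.obj P) ≪≫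
    ((.refl _ ⊗ᵢ L.tensorIso _ _) ≪≫ L.tensorIso _ _)

lemma assocIso_mk {M N P : L.Rep} (m : L.forget.obj M) (n : L.forget.obj N)
    (p : L.forget.obj P) :
    (L.assocIso M N P).hom.hom (Diamond.mk k R (M := L.forget.obj (L.tensor M N))
        (N := L.forget.obj P) ((L.tensorEquiv M N) (Diamond.mk k R m n)) p) =
      Diamond.mk k R m ((L.tensorEquiv N P) (Diamond.mk k R n p)) := rfl

lemma assocIso_act {M N P : L.Rep} (m : L.forget.obj M) (n : L.forget.obj N)
    (p : L.forget.obj P) (D : Diamond k R L L) :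
    (L.assocIso M N P).hom.hom (L.toEnvRing.act (L.forget.obj (L.tensor M N)) (L.forget.obj P) D
        ((L.tensorEquiv M N) (Diamond.mk k R m n)) p) =
      L.act₃ m n p (Diamond.assoc k R L L L (Diamond.map L.comulLin LinearMap.id D)) := by
  induction D using Diamond.induction with
  | h0 => simp only [map_zero, AddMonoidHom.zero_apply]; rfl
  | hadd s t hs ht =>
    simp only [map_add, AddMonoidHom.add_apply, ← hs, ← ht]
    exact map_add (L.assocIso M N P).hom.hom _ _
  | hmk x y =>
    rw [Diamond.map_mk, EnvRing.act_mk]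
    change (L.assocIso M N P).hom.hom (Diamond.mk k R (M := L.forget.obj (L.tensor M N))
        (N := L.forget.obj P) ((L.tensorEquiv M N)
          (L.toEnvRing.act (L.forget.obj M) (L.forget.obj N) (L.comulLin x) m n)) (y • p)) =
      L.act₃ m n p (Diamond.assoc k R L L L (Diamond.mk k R (L.comulLin x) y))
    generalize L.comulLin x = E
    induction E using Diamond.induction with
    | h0 => simp only [map_zero, AddMonoidHom.zero_apply]; rfl
    | hadd s t hs ht =>
      simp only [map_add, AddMonoidHom.add_apply, ← hs, ← ht]
      exact map_add (L.assocIso M N P).hom.hom _ _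
    | hmk z w => rfl

lemma act_act₃ {M N P : L.Rep} (m : L.forget.obj M) (n : L.forget.obj N)
    (p : L.forget.obj P) (D : Diamond k R L L) :
    L.toEnvRing.act (L.forget.obj M) (L.forget.obj (L.tensor N P)) D m
        ((L.tensorEquiv N P) (Diamond.mk k R n p)) =
      L.act₃ m n p (Diamond.map LinearMap.id L.comulLin D) := by
  induction D using Diamond.induction with
  | h0 => simp only [map_zero, AddMonoidHom.zero_apply]
  | hadd s t hs ht => simp only [map_add, AddMonoidHom.add_apply, hs, ht]
  | hmk x y => rfl

lemma assocIso_smul (M N P : L.Rep) (x : L) (t : L.forget.obj (L.tensor (L.tensor M N) P)) :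
    (L.assocIso M N P).hom.hom (x • t) = x • (L.assocIso M N P).hom.hom t := by
  have h0 : (L.assocIso M N P).hom.hom (x • (0 : L.forget.obj (L.tensor (L.tensor M N) P))) =
      x • (L.assocIso M N P).hom.hom (0 : L.forget.obj (L.tensor (L.tensor M N) P)) := by
    rw [smul_zero, map_zero, smul_zero]
  have hadd : ∀ s t : L.forget.obj (L.tensor (L.tensor M N) P),
      (L.assocIso M N P).hom.hom (x • s) = x • (L.assocIso M N P).hom.hom s →
      (L.assocIso M N P).hom.hom (x • t) = x • (L.assocIso M N P).hom.hom t →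
      (L.assocIso M N P).hom.hom (x • (s + t)) = x • (L.assocIso M N P).hom.hom (s + t) :=
    fun s t hs ht => by rw [smul_add, map_add, map_add, smul_add, hs, ht]
  refine Diamond.induction (k := k) (R := R) (M := L.forget.obj (L.tensor M N))
    (N := L.forget.obj P) (p := fun t : L.forget.obj (L.tensor (L.tensor M N) P) =>
      (L.assocIso M N P).hom.hom (x • t) = x • (L.assocIso M N P).hom.hom t)
      h0 (fun u p => ?_) hadd t
  refine Diamond.induction (k := k) (R := R) (M := L.forget.obj M) (N := L.forget.obj N)
    (p := fun u : Diamond k R _ _ =>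
      (L.assocIso M N P).hom.hom ((x • Diamond.mk k R (L.tensorEquiv M N u) p :
        Diamond k R (L.forget.obj (L.tensor M N)) (L.forget.obj P))) =
      (x • (L.assocIso M N P).hom.hom (Diamond.mk k R (L.tensorEquiv M N u) p) :
        L.forget.obj (L.tensor M (L.tensor N P))))
    ?_ (fun m n => ?_) (fun u v hu hv => ?_) u
  · rw [map_zero, map_zero, AddMonoidHom.zero_apply]
    exact h0
  · rw [PreTakeuchiBialgebra.smul_mk]
    refine (L.assocIso_act m n p _).trans ?_
    refine (congrArg (L.act₃ m n p) (L.coassoc x)).trans ?_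
    exact (L.act_act₃ m n p _).symm
  · rw [map_add, map_add, AddMonoidHom.add_apply]
    exact hadd _ _ hu hv

/-- The left unit isomorphism of the underlying `R ⊗ R̄`-modules. -/
def lidIso (M : L.Rep) : L.forget.obj (L.tensor L.unitObj M) ≅ L.forget.obj M :=
  ((L.tensorIso _ _).symm ≪≫ (L.unitIso.symm ⊗ᵢ .refl _)) ≪≫ λ_ (L.forget.obj M)

/-- The right unit isomorphism of the underlying `R ⊗ R̄`-modules. -/
def ridIso (M : L.Rep) : L.forget.obj (L.tensor M L.unitObj) ≅ L.forget.obj M :=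
  ((L.tensorIso _ _).symm ≪≫ (.refl _ ⊗ᵢ L.unitIso.symm)) ≪≫ ρ_ (L.forget.obj M)

lemma lidIso_mk {M : L.Rep} (s : R) (m : L.forget.obj M) :
    (L.lidIso M).hom.hom (Diamond.mk k R (M := L.forget.obj L.unitObj)
      (N := L.forget.obj M) (L.unitEquiv s) m) = inc k s • m := rfl

lemma ridIso_mk {M : L.Rep} (m : L.forget.obj M) (s : R) :
    (L.ridIso M).hom.hom (Diamond.mk k R (M := L.forget.obj M)
      (N := L.forget.obj L.unitObj) m (L.unitEquiv s)) = bar k s • m := rfl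

lemma lidIso_act {M : L.Rep} (m : L.forget.obj M) (D : Diamond k R L L) :
    (L.lidIso M).hom.hom (L.toEnvRing.act (L.forget.obj L.unitObj) (L.forget.obj M) D
        (L.unitEquiv (1 : R)) m) =
      (Diamond.lid k R L (Diamond.map L.counitLin LinearMap.id D)) • m := by
  induction D using Diamond.induction with
  | h0 => simp only [map_zero, AddMonoidHom.zero_apply, zero_smul]; rfl
  | hadd s t hs ht =>
    simp only [map_add, AddMonoidHom.add_apply, add_smul, ← hs, ← ht]
    exact map_add (L.lidIso M).hom.hom _ _
  | hmk x y =>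
    rw [Diamond.map_mk, Diamond.lid_mk, smul_assoc]
    rfl

lemma ridIso_act {M : L.Rep} (m : L.forget.obj M) (D : Diamond k R L L) :
    (L.ridIso M).hom.hom (L.toEnvRing.act (L.forget.obj M) (L.forget.obj L.unitObj) D
        m (L.unitEquiv (1 : R))) =
      (Diamond.rid k R L (Diamond.map LinearMap.id L.counitLin D)) • m := by
  induction D using Diamond.induction with
  | h0 => simp only [map_zero, AddMonoidHom.zero_apply, zero_smul]; rfl
  | hadd s t hs ht =>
    simp only [map_add, AddMonoidHom.add_apply, add_smul, ← hs, ← ht]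
    exact map_add (L.ridIso M).hom.hom _ _
  | hmk x y =>
    rw [Diamond.map_mk, Diamond.rid_mk, smul_assoc]
    rfl

lemma lidIso_smul (M : L.Rep) (x : L) (t : L.forget.obj (L.tensor L.unitObj M)) :
    (L.lidIso M).hom.hom (x • t) = x • (L.lidIso M).hom.hom t := by
  have key : ∀ m : L.forget.obj M, ∀ u : L.forget.obj (L.tensor L.unitObj M),
      u = Diamond.mk k R (L.unitEquiv (1 : R)) m →
      (L.lidIso M).hom.hom (x • u) = x • (L.lidIso M).hom.hom u := by
    rintro m _ rfl
    refine (L.lidIso_act m _).trans ((congrArg (· • m) (L.lid_counit x)).trans ?_)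
    refine congrArg (x • ·) ((L.lidIso_mk 1 m).trans ?_).symm
    rw [inc_one, one_smul]
  refine Diamond.induction (k := k) (R := R) (M := L.forget.obj L.unitObj)
    (N := L.forget.obj M) (p := fun t : L.forget.obj (L.tensor L.unitObj M) =>
      (L.lidIso M).hom.hom (x • t) = x • (L.lidIso M).hom.hom t) ?_ (fun s m => ?_)
      (fun s t hs ht => ?_) t
  · exact key 0 _ (map_zero _).symm
  · refine key (inc k (L.unitEquiv.symm s) • m) _ ?_
    rw [← Diamond.mk_bar, ← map_smul, bar_smul_base, one_mul, LinearEquiv.apply_symm_apply]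
  · exact (congrArg _ (smul_add x s t)).trans ((map_add (L.lidIso M).hom.hom _ _).trans
      ((congrArg₂ (· + ·) hs ht).trans ((smul_add _ _ _).symm.trans
        (congrArg (x • ·) (map_add (L.lidIso M).hom.hom s t).symm))))

lemma ridIso_smul (M : L.Rep) (x : L) (t : L.forget.obj (L.tensor M L.unitObj)) :
    (L.ridIso M).hom.hom (x • t) = x • (L.ridIso M).hom.hom t := by
  have key : ∀ m : L.forget.obj M, ∀ u : L.forget.obj (L.tensor M L.unitObj),
      u = Diamond.mk k R m (L.unitEquiv (1 : R)) →
      (L.ridIso M).hom.hom (x • u) = x • (L.ridIso M).hom.hom u := by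
    rintro m _ rfl
    refine (L.ridIso_act m _).trans ((congrArg (· • m) (L.rid_counit x)).trans ?_)
    refine congrArg (x • ·) ((L.ridIso_mk m 1).trans ?_).symm
    rw [bar_one, one_smul]
  refine Diamond.induction (k := k) (R := R) (M := L.forget.obj M)
    (N := L.forget.obj L.unitObj) (p := fun t : L.forget.obj (L.tensor M L.unitObj) =>
      (L.ridIso M).hom.hom (x • t) = x • (L.ridIso M).hom.hom t) ?_ (fun m s => ?_)
      (fun s t hs ht => ?_) t
  · refine key 0 _ ?_
    rw [map_zero, AddMonoidHom.zero_apply]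
  · refine key (bar k (L.unitEquiv.symm s) • m) _ ?_
    rw [Diamond.mk_bar, ← map_smul, inc_smul_base, mul_one, LinearEquiv.apply_symm_apply]
  · exact (congrArg _ (smul_add x s t)).trans ((map_add (L.ridIso M).hom.hom _ _).trans
      ((congrArg₂ (· + ·) hs ht).trans ((smul_add _ _ _).symm.trans
        (congrArg (x • ·) (map_add (L.ridIso M).hom.hom s t).symm))))

instance repStruct : MonoidalCategoryStruct L.Rep where
  tensorObj := L.tensor
  whiskerLeft M N₁ N₂ g := L.homMk
    ((L.tensorIso M N₁).inv ≫ L.forget.obj M ◁ L.forget.map g ≫ (L.tensorIso M N₂).hom)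
    (L.map_smul_tensor (𝟙 M) g)
  whiskerRight {M₁ M₂} f N := L.homMk
    ((L.tensorIso M₁ N).inv ≫ L.forget.map f ▷ L.forget.obj N ≫ (L.tensorIso M₂ N).hom)
    (L.map_smul_tensor f (𝟙 N))
  tensorHom {M₁ M₂ N₁ N₂} f g := L.homMk
    ((L.tensorIso M₁ N₁).inv ≫ (L.forget.map f ⊗ₘ L.forget.map g) ≫ (L.tensorIso M₂ N₂).hom) (L.map_smul_tensor f g)
  tensorUnit := L.unitObj
  associator M N P := L.isoMk (L.assocIso M N P) (L.assocIso_smul M N P)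
  leftUnitor M := L.isoMk (L.lidIso M) (L.lidIso_smul M)
  rightUnitor M := L.isoMk (L.ridIso M) (L.ridIso_smul M)

/-- The structure isomorphisms of the underlying functor are identities. -/
def forgetData : Monoidal.InducingFunctorData L.forget where
  μIso := L.tensorIso
  whiskerLeft_eq _ _ _ _ := rfl
  whiskerRight_eq _ _ := rfl
  tensorHom_eq _ _ := rfl
  εIso := L.unitIso
  associator_eq _ _ _ := rfl
  leftUnitor_eq _ := rfl
  rightUnitor_eq _ := rfl

/-- The monoidal category of `L`-modules. -/
instance repMonoidal : MonoidalCategory L.Rep := Monoidal.induced L.forget L.forgetData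

/-- The underlying functor is (strictly) monoidal. -/
instance forgetMonoidal : L.forget.Monoidal := Monoidal.fromInducedMonoidal L.forget L.forgetData

end TakeuchiBialgebra

end RepCategories

section Hopf

variable {k : Type v} [CommRing k] {R : Type u} [Ring R] [Algebra k R]

namespace TakeuchiBialgebra

variable (L : TakeuchiBialgebra k R)

/-- `L ⊗_{R̄} L`: the quotient of `L ⊗ L` by all `ℓ r̄ ⊗ m - ℓ ⊗ r̄ m`. -/
abbrev BarTensor : Type u :=
  (L ⊗[k] L) ⧸ AddSubgroup.closure {x : L ⊗[k] L | ∃ (r : R) (l m : L),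
    x = (l * L.toEnvRing.unit (bar k r)) ⊗ₜ m - l ⊗ₜ (L.toEnvRing.unit (bar k r) * m)}

/-- The biadditive map `(ℓ, m) ↦ ∑ ℓ₁ ⊗ ℓ₂ m`. -/
def galoisAux : L →+ L →+ Diamond k R L L :=
  AddMonoidHom.mk' (fun l => L.toEnvRing.act L L (L.comul l) (1 : L)) fun l l' => by
    rw [map_add, AddSubgroup.coe_add, map_add, AddMonoidHom.add_apply]

lemma galoisAux_bar (r : R) (l m : L) :
    L.galoisAux (l * L.toEnvRing.unit (bar k r)) m =
      L.galoisAux l (L.toEnvRing.unit (bar k r) * m) := by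
  change L.toEnvRing.act L L (L.comul (l * L.toEnvRing.unit (bar k r))) (1 : L) m = _
  rw [map_mul, EnvRing.coe_mul, ← EnvRing.takeuchiAct_act]
  change L.toEnvRing.takeuchiAct L L (L.comul l) (L.toEnvRing.act L L
    (L.comul (L.toEnvRing.unit ((1 : R) ⊗ₜ[k] op r))) (1 : L) m) = _
  rw [L.comul_unit, EnvRing.act_mk, ← Algebra.TensorProduct.one_def, map_one, one_smul]
  rfl

/-- The Galois map `β : L ⊗_{R̄} L → L ⋄ L`, `ℓ ⊗ m ↦ ∑ ℓ₁ ⊗ ℓ₂ m`. -/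
def galois : L.BarTensor →+ Diamond k R L L :=
  QuotientAddGroup.lift _
    (TensorProduct.liftAddHom L.galoisAux fun c l m => by
      have h : ∀ x : L, c • x = L.toEnvRing.unit (bar k (algebraMap k R c)) * x := fun x => by
        rw [← algebraMap_eq_bar, AlgHom.commutes, Algebra.smul_def]
      have h' : c • l = l * L.toEnvRing.unit (bar k (algebraMap k R c)) := by
        rw [← algebraMap_eq_bar, AlgHom.commutes, ← Algebra.commutes, Algebra.smul_def]
      rw [h m, h', galoisAux_bar])
    ((AddSubgroup.closure_le _).2 (by
      rintro _ ⟨r, l, m, rfl⟩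
      exact (map_sub _ _ _).trans (sub_eq_zero.2 (L.galoisAux_bar r l m))))

/-- `L` is a `×_R`-Hopf algebra if its Galois map is bijective. -/
def IsHopf : Prop := Function.Bijective L.galois

end TakeuchiBialgebra

end Hopf

section SqmBaseChange

open scoped ModuleCat.Algebra

variable {k : Type v} [CommRing k] {R S : Type u} [Ring R] [Algebra k R] [Ring S] [Algebra k S]

/-- A monoidal functor from `R`-bimodules to `S`-bimodules is a `√M`-equivalence if it is an
equivalence of `k`-linear monoidal categories. -/
structure IsSqmEquivalence (F : BimodCat k R ⥤ BimodCat k S) [F.Monoidal] : Prop where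
  isEquivalence : F.IsEquivalence
  additive : F.Additive
  linear : F.Linear k

/-- The `×_S`-bialgebra `L'` is obtained from the `×_R`-bialgebra `L` by base change along the
monoidal functor `F` from `R`-bimodules to `S`-bimodules: there is a monoidal equivalence `G` from
`L`-modules to `L'`-modules such that the square formed by `F`, `G` and the underlying functors
commutes as a diagram of monoidal functors, that is, up to a monoidal natural isomorphism.
(For given `F` and `L` this determines the `×_S`-bialgebra `L'` up to isomorphism.) -/
def IsBaseChange (F : BimodCat k R ⥤ BimodCat k S) [F.Monoidal]
    (L : TakeuchiBialgebra k R) (L' : TakeuchiBialgebra k S) : Prop :=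
  ∃ (G : L.Rep ⥤ L'.Rep) (_ : G.Monoidal) (e : L.forget ⋙ F ≅ G ⋙ L'.forget),
    G.IsEquivalence ∧ NatTrans.IsMonoidal e.hom

end SqmBaseChange

end QuantumGroupoid

end

/-!
The `×_R`-Hopf property of `L` is expressed purely in terms of the monoidal functor
`U : L-Mod ⥤ R^e-Mod`, where `R^e = R ⊗ R̄`, so that monoidal equivalences transport it.

Call `U` a Hopf functor (`IsHopfFunctor`) if, whenever `η : X ⟶ U Y` exhibits `Y` as the free object
on `X`, the morphism `X ⋄ U N ⟶ U Y ⋄ U N ≅ U (Y ⋄ N)` exhibits `Y ⋄ N` as the free object on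
`X ⋄ U N`, for all `N`. Equivalences `F` and `G` with `U ⋙ F ≅ G ⋙ U'` preserve and reflect
universal arrows; if they and the isomorphism are monoidal, they also respect the passage from `η`
to the tensored morphism. Hence `U` is a Hopf functor if and only if `U'` is
(`isHopfFunctor_iff`).

It remains to see that `L` is a `×_R`-Hopf algebra if and only if `U` is a Hopf functor
(`TakeuchiBialgebra.isHopf_iff_isHopfFunctor`). The intermediate condition is that every `R̄`-linear
map `f : N → P` into an `L`-module has a unique `L`-linear extension `φ : L ⋄ N → P` with
`φ(1 ⊗ n) = f(n)` (`TakeuchiBialgebra.HasUniqueExtensions`).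

* For `N = L` this says that `β` is bijective, because `L ⊗_{R̄} L` has this universal property
  (`isHopf_iff_hasUniqueExtensions`), and the case `N = L` implies the case of arbitrary `N`
  (`HasUniqueExtensions.of_self`).
* Tensoring with `N` has a right adjoint on `L`-modules, the module `InnerHom` of `L`-linear maps
  `L ⋄ N → P`, with `L` acting through right multiplication on the first factor. Unique extensions
  identify `R^e`-linear maps `X ⋄ N → P` with `R^e`-linear maps `X → InnerHom`; if `Y` is free on
  `X`, these are the `L`-linear maps `Y → InnerHom`, hence the `L`-linear maps `Y ⋄ N → P`
  (`HasUniqueExtensions.isHopfFunctor`).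
* Conversely, the Hopf functor condition for the free object `L` on `R^e` and for `N = L` returns
  unique extensions (`hasUniqueExtensions_of_isHopfFunctor`), because `R^e`-linear maps
  `R^e ⋄ L → P` amount to `R̄`-linear maps `L → P`.
-/

noncomputable section

namespace QuantumGroupoid

/-! ### Hopf functors and their invariance under monoidal equivalences -/

section HopfFunctor

open MonoidalCategory Functor.LaxMonoidal

universe v₁ v₂ v₃ v₄ u₁ u₂ u₃ u₄

variable {C : Type u₁} [Category.{v₁} C] {D : Type u₂} [Category.{v₂} D]
  {C' : Type u₃} [Category.{v₃} C'] {D' : Type u₄} [Category.{v₄} D']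

/-- A morphism `η : X ⟶ U Y` is a universal arrow from `X` to the functor `U`: it exhibits `Y` as
the free object on `X`. -/
def IsUniversalArrow (U : D ⥤ C) {X : C} {Y : D} (η : X ⟶ U.obj Y) : Prop :=
  ∀ P : D, Function.Bijective fun g : Y ⟶ P => η ≫ U.map g

lemma isUniversalArrow_iso_comp_iff (U : D ⥤ C) {X X' : C} {Y : D} (i : X ≅ X')
    (η : X' ⟶ U.obj Y) : IsUniversalArrow U (i.hom ≫ η) ↔ IsUniversalArrow U η :=
  forall_congr' fun P => by
    rw [← Function.Bijective.of_comp_iff' (i.symm.homFromEquiv (Z := U.obj P)).symm.bijective]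
    refine iff_of_eq (congrArg _ (funext fun g => ?_))
    simp

lemma isUniversalArrow_comp_map_iso_iff (U : D ⥤ C) {X : C} {Y Y' : D} (η : X ⟶ U.obj Y)
    (j : Y ≅ Y') : IsUniversalArrow U (η ≫ U.map j.hom) ↔ IsUniversalArrow U η :=
  forall_congr' fun P => by
    rw [← Function.Bijective.of_comp_iff _ (j.homFromEquiv (Z := P)).bijective]
    refine iff_of_eq (congrArg _ (funext fun g => ?_))
    simp

/-- Equivalences that commute with `U` and `U'` preserve and reflect universal arrows. -/
lemma isUniversalArrow_map_iff {U : D ⥤ C} {U' : D' ⥤ C'} {F : C ⥤ C'} {G : D ⥤ D'}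
    [F.IsEquivalence] [G.IsEquivalence] (e : U ⋙ F ≅ G ⋙ U') {X : C} {Y : D} (η : X ⟶ U.obj Y) :
    IsUniversalArrow U' (F.map η ≫ e.hom.app Y) ↔ IsUniversalArrow U η := by
  -- Objects in the image of `G` are tested first; every object is isomorphic to one of them.
  have key : ∀ P : D, (Function.Bijective fun g : G.obj Y ⟶ G.obj P =>
      (F.map η ≫ e.hom.app Y) ≫ U'.map g) ↔
      Function.Bijective fun g : Y ⟶ P => η ≫ U.map g := fun P => by
    rw [← Function.Bijective.of_comp_iff _
        (Functor.FullyFaithful.ofFullyFaithful G |>.homEquiv (X := Y) (Y := P)).bijective,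
      ← Function.Bijective.of_comp_iff' (Functor.FullyFaithful.ofFullyFaithful F |>.homEquiv
        (X := X) (Y := U.obj P)).bijective,
      ← Function.Bijective.of_comp_iff' ((e.app P).homToEquiv (Z := F.obj X)).bijective]
    refine iff_of_eq (congrArg _ (funext fun g => ?_))
    have h := e.hom.naturality g
    dsimp at h
    simp [← h]
  refine ⟨fun h P => (key P).1 (h _), fun h P' => ?_⟩
  rw [← Function.Bijective.of_comp_iff'
      ((U'.mapIso (G.objObjPreimageIso P').symm).homToEquiv (Z := F.obj X)).bijective,
    ← Function.Bijective.of_comp_iff _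
      ((G.objObjPreimageIso P').homToEquiv (Z := G.obj Y)).bijective]
  convert (key (G.objPreimage P')).2 (h _) using 2 with g
  simp [← Functor.map_comp]

variable [MonoidalCategory C] [MonoidalCategory D] [MonoidalCategory C'] [MonoidalCategory D']

/-- A monoidal functor `U` is a (left) Hopf functor if `Y ⊗ N` is free on `X ⊗ U N` whenever `Y` is
free on `X`. When `U` has a left adjoint `T`, this says that the Hopf operators
`T (X ⊗ U N) ⟶ T X ⊗ N` are invertible. -/
def IsHopfFunctor (U : D ⥤ C) [U.LaxMonoidal] : Prop :=
  ∀ ⦃X : C⦄ ⦃Y : D⦄ (η : X ⟶ U.obj Y) (N : D), IsUniversalArrow U η →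
    IsUniversalArrow U (η ▷ U.obj N ≫ μ U Y N)

/-- Up to the structure isomorphisms, tensoring the image of `η` with `G N` gives the image of `η`
tensored with `N`. -/
lemma isUniversalArrow_tensor_map_iff {U : D ⥤ C} [U.Monoidal] {U' : D' ⥤ C'} [U'.Monoidal]
    {F : C ⥤ C'} [F.Monoidal] {G : D ⥤ D'} [G.Monoidal] [F.IsEquivalence] [G.IsEquivalence]
    (e : U ⋙ F ≅ G ⋙ U') [NatTrans.IsMonoidal e.hom] {X : C} {Y : D} (η : X ⟶ U.obj Y) (N : D) :
    IsUniversalArrow U' ((F.map η ≫ e.hom.app Y) ▷ U'.obj (G.obj N) ≫ μ U' (G.obj Y) (G.obj N)) ↔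
      IsUniversalArrow U (η ▷ U.obj N ≫ μ U Y N) := by
  rw [← isUniversalArrow_map_iff e, ← isUniversalArrow_comp_map_iso_iff U' _
      (Functor.Monoidal.μIso G Y N), ← isUniversalArrow_iso_comp_iff U'
      (whiskerLeftIso (F.obj X) (e.app N)), ← isUniversalArrow_iso_comp_iff U'
      (Functor.Monoidal.μIso F X (U.obj N)) (F.map _ ≫ _)]
  refine iff_of_eq (congrArg _ ?_)
  have h := NatTrans.IsMonoidal.tensor (τ := e.hom) Y N
  simp only [comp_μ, Category.assoc] at h
  simp only [whiskerLeftIso_hom, Iso.app_hom, Functor.Monoidal.μIso_hom, Functor.map_comp,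
    Category.assoc, comp_whiskerRight]
  rw [← μ_natural_left_assoc, h]
  simp [MonoidalCategory.tensorHom_def, whisker_exchange_assoc]

/-- Being a Hopf functor is invariant under monoidal equivalences. -/
theorem isHopfFunctor_iff {U : D ⥤ C} [U.Monoidal] {U' : D' ⥤ C'} [U'.Monoidal]
    {F : C ⥤ C'} [F.Monoidal] {G : D ⥤ D'} [G.Monoidal] [F.IsEquivalence] [G.IsEquivalence]
    (e : U ⋙ F ≅ G ⋙ U') [NatTrans.IsMonoidal e.hom] :
    IsHopfFunctor U' ↔ IsHopfFunctor U := by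
  refine ⟨fun h X Y η N hη => (isUniversalArrow_tensor_map_iff e η N).1
    (h _ _ ((isUniversalArrow_map_iff e η).2 hη)), fun h X' Y' η' N' hη' => ?_⟩
  -- By essential surjectivity every universal arrow of `U'` is isomorphic to the image of one of `U`.
  let i := F.objObjPreimageIso X'
  let j := G.objObjPreimageIso Y'
  let l := G.objObjPreimageIso N'
  obtain ⟨η, hη⟩ := F.map_surjective
    ((i.hom ≫ η' ≫ U'.map j.symm.hom) ≫ e.inv.app (G.objPreimage Y'))
  have hη'' : F.map η ≫ e.hom.app _ = i.hom ≫ η' ≫ U'.map j.symm.hom := by simp [hη]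
  have h₁ : IsUniversalArrow U η := by
    rwa [← isUniversalArrow_map_iff e, hη'', isUniversalArrow_iso_comp_iff,
      isUniversalArrow_comp_map_iso_iff]
  have h₂ := (isUniversalArrow_tensor_map_iff e η (G.objPreimage N')).2 (h η _ h₁)
  rw [hη''] at h₂
  rw [← isUniversalArrow_comp_map_iso_iff U' _ (j.symm ⊗ᵢ l.symm),
    ← isUniversalArrow_iso_comp_iff U' (i ⊗ᵢ U'.mapIso l)]
  convert h₂ using 1
  simp only [tensorIso_hom, Iso.symm_hom, Functor.mapIso_hom, Category.assoc, ← μ_natural,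
    ← tensorHom_id, tensorHom_comp_tensorHom_assoc, ← Functor.map_comp, Iso.hom_inv_id,
    Category.id_comp]
  rw [CategoryTheory.Functor.map_id]

end HopfFunctor

/-! ### Linear maps on tensor products of modules -/

section Extension

variable {k : Type v} [CommRing k] {R : Type u} [Ring R] [Algebra k R]

namespace TakeuchiBialgebra

variable (L : TakeuchiBialgebra k R)

section Linear

variable {M M' N N' : Type*}
  [AddCommGroup M] [Module (Env k R) M] [Module L M] [IsScalarTower (Env k R) L M]
  [AddCommGroup M'] [Module (Env k R) M'] [Module L M'] [IsScalarTower (Env k R) L M']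
  [AddCommGroup N] [Module (Env k R) N] [Module L N] [IsScalarTower (Env k R) L N]
  [AddCommGroup N'] [Module (Env k R) N'] [Module L N'] [IsScalarTower (Env k R) L N']

/-- `f ⋄ g` as an `L`-linear map, for `L`-linear maps `f` and `g`. -/
def diamondMap (f : M →ₗ[L] M') (g : N →ₗ[L] N') : Diamond k R M N →ₗ[L] Diamond k R M' N' where
  toFun := Diamond.map (f.restrictScalars (Env k R)) (g.restrictScalars (Env k R))
  map_add' := map_add _
  map_smul' x t := by
    rw [RingHom.id_apply]
    induction t using Diamond.induction with
    | h0 => simp only [smul_zero, map_zero]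
    | hadd s t hs ht => simp only [smul_add, map_add, hs, ht]
    | hmk m n =>
      rw [Diamond.map_mk, PreTakeuchiBialgebra.smul_mk, PreTakeuchiBialgebra.smul_mk]
      generalize (L.comul x : Diamond k R L L) = D
      induction D using Diamond.induction with
      | h0 => simp only [map_zero, AddMonoidHom.zero_apply]
      | hadd s t hs ht => simp only [map_add, AddMonoidHom.add_apply, hs, ht]
      | hmk y z => simp

@[simp] lemma diamondMap_mk (f : M →ₗ[L] M') (g : N →ₗ[L] N') (m : M) (n : N) :
    L.diamondMap f g (Diamond.mk k R m n) = Diamond.mk k R (f m) (g n) := rfl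

variable {L} in
lemma diamondHom_ext {P : Type*} [AddCommGroup P] [Module L P]
    {f g : Diamond k R M N →ₗ[L] P}
    (h : ∀ m n, f (Diamond.mk k R m n) = g (Diamond.mk k R m n)) : f = g :=
  LinearMap.toAddMonoidHom_injective (Diamond.addHom_ext h)

lemma unit_bar_smul_mk (r : R) (m : M) (n : N) :
    L.toEnvRing.unit (bar k r) • Diamond.mk k R m n = Diamond.mk k R m (bar k r • n) := by
  rw [PreTakeuchiBialgebra.unit_smul_diamond, Diamond.bar_smul_mk]

lemma unit_inc_smul_mk (r : R) (m : M) (n : N) :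
    L.toEnvRing.unit (inc k r) • Diamond.mk k R m n = Diamond.mk k R (inc k r • m) n := by
  rw [PreTakeuchiBialgebra.unit_smul_diamond, Diamond.inc_smul_mk]

/-- Promotes an additive map on `M ⋄ N` to an `L`-linear one, where linearity is checked on
elements `m ⊗ n`, on which `x` acts by `Δ(x)`. -/
def diamondHomMk {P : Type*} [AddCommGroup P] [Module L P] (φ : Diamond k R M N →+ P)
    (h : ∀ (x : L) m n, φ (L.toEnvRing.act M N (L.comul x) m n) = x • φ (Diamond.mk k R m n)) :
    Diamond k R M N →ₗ[L] P :=
  { φ with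
    map_smul' := fun x t => by
      dsimp only [ZeroHom.toFun_eq_coe, AddMonoidHom.toZeroHom_coe, RingHom.id_apply]
      induction t using Diamond.induction with
      | h0 => simp only [smul_zero, map_zero]
      | hadd s t hs ht => simp only [smul_add, map_add, hs, ht]
      | hmk m n => exact h x m n }

end Linear

/-! ### Unique extensions of `R̄`-linear maps -/

/-- Every `R̄`-linear map `f : N → P` into an `L`-module extends uniquely along `n ↦ 1 ⊗ n` to an
`L`-linear map `L ⋄ N → P`. Equivalently, the canonical map `L ⊗_{R̄} N → L ⋄ N` is bijective. -/
def HasUniqueExtensions (N : Type u) [AddCommGroup N] [Module (Env k R) N] [Module L N]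
    [IsScalarTower (Env k R) L N] : Prop :=
  ∀ (P : Type u) [AddCommGroup P] [Module L P] (f : N →+ P),
    (∀ (r : R) n, f (bar k r • n) = L.toEnvRing.unit (bar k r) • f n) →
    ∃! φ : Diamond k R L N →ₗ[L] P, ∀ n, φ (Diamond.mk k R (1 : L) n) = f n

section Extensions

variable {L}
variable {N : Type u} [AddCommGroup N] [Module (Env k R) N] [Module L N]
    [IsScalarTower (Env k R) L N] {P : Type u} [AddCommGroup P] [Module L P]

lemma HasUniqueExtensions.hom_ext (h : L.HasUniqueExtensions N)
    {φ ψ : Diamond k R L N →ₗ[L] P}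
    (hφ : ∀ n, φ (Diamond.mk k R (1 : L) n) = ψ (Diamond.mk k R (1 : L) n)) : φ = ψ :=
  (h P (ψ.toAddMonoidHom.comp (Diamond.mk k R (1 : L))) fun r n => by
    change ψ (Diamond.mk k R (1 : L) (bar k r • n)) = _ • ψ (Diamond.mk k R (1 : L) n)
    rw [← L.unit_bar_smul_mk, map_smul]).unique hφ fun _ => rfl

/-- Unique extensions from `L ⋄ L` give unique extensions from `L ⋄ N`: if `φₙ` is the extension of
`ℓ ↦ f (ℓ n)`, then the extension of `f` is `ℓ ⊗ n ↦ φₙ (ℓ ⊗ 1)`. -/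
lemma HasUniqueExtensions.of_self (h : L.HasUniqueExtensions L) : L.HasUniqueExtensions N := by
  intro P _ _ f hf
  have hex : ∀ n : N, ∃ φ : Diamond k R L L →ₗ[L] P,
      ∀ m : L, φ (Diamond.mk k R (1 : L) m) = f (m • n) := fun n =>
    (h P (f.comp ((LinearMap.toSpanSingleton L N n).toAddMonoidHom)) fun r m => by
      change f ((bar k r • m) • n) = _ • f (m • n)
      rw [smul_assoc, hf]).exists
  choose Φ hΦ using hex
  -- By uniqueness `Φ n` is additive in `n`, and `Φ (z n)` is `Φ n` composed with right multiplication
  -- by `z` on the second factor; the latter gives both the balancing and the linearity of `φ`.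
  have hΦadd : ∀ n n' : N, Φ (n + n') = Φ n + Φ n' := fun n n' => h.hom_ext fun m => by
    rw [LinearMap.add_apply, hΦ, hΦ, hΦ, smul_add, map_add]
  have hΦsmul : ∀ (z : L) (n : N) (x : L), Φ (z • n) (Diamond.mk k R x (1 : L)) =
      Φ n (Diamond.mk k R x z) := fun z n x => by
    have h' : Φ (z • n) =
        Φ n ∘ₗ L.diamondMap LinearMap.id (LinearMap.toSpanSingleton L L z) :=
      h.hom_ext fun m => by
        rw [hΦ, LinearMap.comp_apply, diamondMap_mk, LinearMap.id_apply,
          LinearMap.toSpanSingleton_apply, hΦ, smul_eq_mul, mul_smul]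
    rw [h', LinearMap.comp_apply, diamondMap_mk, LinearMap.id_apply,
      LinearMap.toSpanSingleton_apply, smul_eq_mul, one_mul]
  let φ : Diamond k R L N →+ P := Diamond.lift
    (AddMonoidHom.mk' (fun x : L => AddMonoidHom.mk'
      (fun n => Φ n (Diamond.mk k R x (1 : L))) fun n n' => by rw [hΦadd, LinearMap.add_apply])
      fun x x' => by
        ext n
        change Φ n (Diamond.mk k R (x + x') (1 : L)) =
          Φ n (Diamond.mk k R x (1 : L)) + Φ n (Diamond.mk k R x' (1 : L))
        rw [map_add, AddMonoidHom.add_apply, map_add])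
    fun r x n => by
      change Φ n (Diamond.mk k R (bar k r • x) (1 : L)) =
        Φ (inc k r • n) (Diamond.mk k R x (1 : L))
      rw [← L.toEnvRing.unit_smul (inc k r) n, hΦsmul, Diamond.mk_bar, EnvRing.smul_eq, mul_one]
  have hφ : ∀ x n, φ (Diamond.mk k R x n) = Φ n (Diamond.mk k R x (1 : L)) := fun _ _ => rfl
  refine ⟨L.diamondHomMk φ fun x m n => ?_, fun n => ?_, fun ψ hψ => ?_⟩
  · rw [hφ, ← map_smul, PreTakeuchiBialgebra.smul_mk]
    generalize (L.comul x : Diamond k R L L) = D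
    induction D using Diamond.induction with
    | h0 => simp only [map_zero, AddMonoidHom.zero_apply]
    | hadd s t hs ht => simp only [map_add, AddMonoidHom.add_apply, hs, ht]
    | hmk y z => rw [EnvRing.act_mk, EnvRing.act_mk, hφ, hΦsmul, smul_eq_mul, smul_eq_mul, mul_one]
  · refine (hΦ n 1).trans ?_
    rw [one_smul]
  · refine diamondHom_ext fun x n => ?_
    have h' : Φ n = ψ ∘ₗ L.diamondMap LinearMap.id (LinearMap.toSpanSingleton L N n) :=
      h.hom_ext fun m => by
        rw [hΦ, LinearMap.comp_apply, diamondMap_mk, LinearMap.id_apply,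
          LinearMap.toSpanSingleton_apply, hψ]
    refine Eq.trans ?_ (DFunLike.congr_fun h' (Diamond.mk k R x (1 : L))).symm
    rw [LinearMap.comp_apply, diamondMap_mk, LinearMap.id_apply,
      LinearMap.toSpanSingleton_apply, one_smul]

end Extensions

/-! ### The Galois map and unique extensions -/

section Galois

lemma galois_mk (l m : L) :
    L.galois (QuotientAddGroup.mk (l ⊗ₜ m) : L.BarTensor) = l • Diamond.mk k R (1 : L) m := rfl

variable {L} in
lemma barTensor_addHom_ext {P : Type*} [AddCommGroup P] {f g : L.BarTensor →+ P}
    (h : ∀ l m : L, f (QuotientAddGroup.mk (l ⊗ₜ m)) = g (QuotientAddGroup.mk (l ⊗ₜ m))) :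
    f = g := by
  ext t
  induction t using TensorProduct.induction_on with
  | zero => exact (map_zero f).trans (map_zero g).symm
  | tmul l m => exact h l m
  | add s t hs ht =>
    exact (map_add f _ _).trans ((congrArg₂ (· + ·) hs ht).trans (map_add g _ _).symm)

lemma barTensor_balanced (r : R) (l m : L) :
    (QuotientAddGroup.mk ((l * L.toEnvRing.unit (bar k r)) ⊗ₜ m) : L.BarTensor) =
      QuotientAddGroup.mk (l ⊗ₜ (bar k r • m)) :=
  (QuotientAddGroup.eq_iff_sub_mem).2 (AddSubgroup.subset_closure ⟨r, l, m, rfl⟩)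

/-- The universal property of `L ⊗_{R̄} L` with respect to balanced biadditive maps. -/
def barTensorDesc {P : Type*} [AddCommGroup P] (f : L →+ L →+ P)
    (hf : ∀ (r : R) l m, f (l * L.toEnvRing.unit (bar k r)) m = f l (bar k r • m)) :
    L.BarTensor →+ P :=
  QuotientAddGroup.lift _
    (TensorProduct.liftAddHom f fun c l m => by
      have h : c • m = bar k (algebraMap k R c) • m := by
        rw [← algebraMap_eq_bar, EnvRing.smul_eq, AlgHom.commutes, Algebra.smul_def]
      have h' : c • l = l * L.toEnvRing.unit (bar k (algebraMap k R c)) := by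
        rw [← algebraMap_eq_bar, AlgHom.commutes, ← Algebra.commutes, Algebra.smul_def]
      rw [h, h', hf])
    ((AddSubgroup.closure_le _).2 (by
      rintro _ ⟨r, l, m, rfl⟩
      exact (map_sub _ _ _).trans (sub_eq_zero.2 (hf r l m))))

/-- The universal property of `L ⊗_{R̄} L` as the `L`-module induced from the `R̄`-module `L`:
the additive map `ℓ ⊗ m ↦ ℓ f(m)` for an `R̄`-linear `f`. -/
def barTensorLift {P : Type*} [AddCommGroup P] [Module L P] (f : L →+ P)
    (hf : ∀ (r : R) m, f (bar k r • m) = L.toEnvRing.unit (bar k r) • f m) : L.BarTensor →+ P :=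
  L.barTensorDesc (AddMonoidHom.mk' (fun l : L => (DistribSMul.toAddMonoidHom P l).comp f)
    fun l l' => by
      ext m
      exact add_smul l l' (f m)) fun r l m => by
    change (l * L.toEnvRing.unit (bar k r)) • f m = l • f (bar k r • m)
    rw [mul_smul, hf]

lemma barTensorLift_mk {P : Type*} [AddCommGroup P] [Module L P] (f : L →+ P)
    (hf : ∀ (r : R) m, f (bar k r • m) = L.toEnvRing.unit (bar k r) • f m) (l m : L) :
    L.barTensorLift f hf (QuotientAddGroup.mk (l ⊗ₜ m)) = l • f m := rfl

/-- Left multiplication by `x` on `L ⊗_{R̄} L`. -/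
def barTensorSMul (x : L) : L.BarTensor →+ L.BarTensor :=
  L.barTensorDesc (AddMonoidHom.mk' (fun l : L => AddMonoidHom.mk'
      (fun m : L => (QuotientAddGroup.mk ((x * l) ⊗ₜ m) : L.BarTensor)) fun m m' => by
        rw [tmul_add]; rfl) fun l l' => by
      ext m
      change (QuotientAddGroup.mk ((x * (l + l')) ⊗ₜ m) : L.BarTensor) = _
      rw [mul_add, add_tmul]; rfl) fun r l m => by
    change (QuotientAddGroup.mk ((x * (l * L.toEnvRing.unit (bar k r))) ⊗ₜ m) : L.BarTensor) = _
    rw [← mul_assoc, barTensor_balanced]; rfl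

lemma barTensorSMul_mk (x l m : L) : L.barTensorSMul x (QuotientAddGroup.mk (l ⊗ₜ m)) =
    (QuotientAddGroup.mk ((x * l) ⊗ₜ m) : L.BarTensor) := rfl

/-- The left `L`-module structure of `L ⊗_{R̄} L`, through the left factor. -/
instance barTensorModule : Module L L.BarTensor where
  smul x t := L.barTensorSMul x t
  one_smul t := DFunLike.congr_fun (show L.barTensorSMul 1 = AddMonoidHom.id _ from
    barTensor_addHom_ext fun l m => by
      rw [barTensorSMul_mk, one_mul]; rfl) t
  mul_smul x y t := DFunLike.congr_fun (show L.barTensorSMul (x * y) =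
    (L.barTensorSMul x).comp (L.barTensorSMul y) from barTensor_addHom_ext fun l m => by
      rw [barTensorSMul_mk, mul_assoc]; rfl) t
  smul_zero _ := map_zero _
  smul_add _ := map_add _
  add_smul x y t := DFunLike.congr_fun (show L.barTensorSMul (x + y) =
    L.barTensorSMul x + L.barTensorSMul y from barTensor_addHom_ext fun l m => by
      rw [barTensorSMul_mk, add_mul, add_tmul]; rfl) t
  zero_smul t := DFunLike.congr_fun (show L.barTensorSMul 0 = 0 from
    barTensor_addHom_ext fun l m => by
      rw [barTensorSMul_mk, zero_mul, zero_tmul]; rfl) t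

lemma smul_barTensor_mk (x l m : L) : x • (QuotientAddGroup.mk (l ⊗ₜ m) : L.BarTensor) =
    QuotientAddGroup.mk ((x * l) ⊗ₜ m) := rfl

lemma galois_smul (x : L) (t : L.BarTensor) : L.galois (x • t) = x • L.galois t :=
  DFunLike.congr_fun (show L.galois.comp (L.barTensorSMul x) =
    (DistribSMul.toAddMonoidHom _ x).comp L.galois from barTensor_addHom_ext fun l m => by
      change L.galois (L.barTensorSMul x (QuotientAddGroup.mk (l ⊗ₜ m))) =
        x • L.galois (QuotientAddGroup.mk (l ⊗ₜ m))
      rw [barTensorSMul_mk, galois_mk, galois_mk, mul_smul]) t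

lemma barTensorLift_smul {P : Type*} [AddCommGroup P] [Module L P] (f : L →+ P)
    (hf : ∀ (r : R) m, f (bar k r • m) = L.toEnvRing.unit (bar k r) • f m) (x : L)
    (t : L.BarTensor) : L.barTensorLift f hf (x • t) = x • L.barTensorLift f hf t :=
  DFunLike.congr_fun (show (L.barTensorLift f hf).comp (L.barTensorSMul x) =
    (DistribSMul.toAddMonoidHom _ x).comp (L.barTensorLift f hf) from
      barTensor_addHom_ext fun l m => mul_smul x l (f m)) t

/-- Since `L ⊗_{R̄} L` is the `L`-module induced from the `R̄`-module `L`, and `β` is `L`-linear with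
`β(1 ⊗ m) = 1 ⊗ m`, bijectivity of `β` says that `L ⋄ L` has the same universal property. -/
lemma isHopf_iff_hasUniqueExtensions : L.IsHopf ↔ L.HasUniqueExtensions L := by
  constructor
  · intro h P _ _ f hf
    let E := AddEquiv.ofBijective L.galois h
    have hE : ∀ t, L.galois (E.symm t) = t := E.apply_symm_apply
    refine ⟨{ (L.barTensorLift f hf).comp E.symm.toAddMonoidHom with
        map_smul' := fun x t => ?_ }, fun m => ?_, fun ψ hψ => ?_⟩
    · change L.barTensorLift f hf (E.symm (x • t)) = x • L.barTensorLift f hf (E.symm t)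
      rw [← barTensorLift_smul]
      refine congrArg _ (h.1 ?_)
      rw [hE, galois_smul, hE]
    · change L.barTensorLift f hf (E.symm (Diamond.mk k R (1 : L) m)) = f m
      have h1 : E.symm (Diamond.mk k R (1 : L) m) = QuotientAddGroup.mk ((1 : L) ⊗ₜ m) :=
        h.1 (by rw [hE, galois_mk, one_smul])
      rw [h1, barTensorLift_mk, one_smul]
    · ext t
      change ψ t = L.barTensorLift f hf (E.symm t)
      obtain ⟨s, rfl⟩ := h.2 t
      have h1 : E.symm (L.galois s) = s := E.symm_apply_apply s
      rw [h1]
      refine DFunLike.congr_fun (show ψ.toAddMonoidHom.comp L.galois = L.barTensorLift f hf from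
        barTensor_addHom_ext fun l m => ?_) s
      change ψ (L.galois _) = _
      rw [galois_mk, barTensorLift_mk, map_smul, hψ]
  · intro h
    obtain ⟨φ, hφ, -⟩ := h L.BarTensor
      (AddMonoidHom.mk' (fun m : L => (QuotientAddGroup.mk ((1 : L) ⊗ₜ m) : L.BarTensor))
        fun m m' => by rw [tmul_add]; rfl) fun r m => by
      change (QuotientAddGroup.mk ((1 : L) ⊗ₜ (bar k r • m)) : L.BarTensor) =
        L.toEnvRing.unit (bar k r) • (QuotientAddGroup.mk ((1 : L) ⊗ₜ m) : L.BarTensor)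
      rw [smul_barTensor_mk, mul_one]
      rw [← barTensor_balanced, one_mul]
    have hφ' : ∀ m : L, φ (Diamond.mk k R (1 : L) m) = QuotientAddGroup.mk ((1 : L) ⊗ₜ m) := hφ
    refine Function.bijective_iff_has_inverse.2 ⟨φ, fun t => ?_, fun t => ?_⟩
    · refine DFunLike.congr_fun (show φ.toAddMonoidHom.comp L.galois = AddMonoidHom.id _ from
        barTensor_addHom_ext fun l m => ?_) t
      change φ (L.galois _) = _
      rw [galois_mk, map_smul, hφ', smul_barTensor_mk, mul_one]
      rfl
    · let β : L.BarTensor →ₗ[L] Diamond k R L L := { L.galois with map_smul' := L.galois_smul }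
      refine DFunLike.congr_fun (show β ∘ₗ φ = LinearMap.id from h.hom_ext fun m => ?_) t
      change L.galois (φ _) = _
      rw [hφ', galois_mk, one_smul]
      rfl

end Galois

end TakeuchiBialgebra

end Extension

/-! ### Inner homs of modules over a bialgebra -/

section Currying

variable {k : Type v} [CommRing k] {R : Type u} [Ring R] [Algebra k R]

namespace TakeuchiBialgebra

open MonoidalCategory Functor.LaxMonoidal

variable (L : TakeuchiBialgebra k R)

/-- The map `x ⊗ n ↦ x y ⊗ n` from `L ⋄ N` to `Y ⋄ N` determined by an element `y` of `Y`. -/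
def actLeft {Y N : Type*} [AddCommGroup Y] [Module (Env k R) Y] [Module L Y]
    [IsScalarTower (Env k R) L Y] [AddCommGroup N] [Module (Env k R) N] [Module L N]
    [IsScalarTower (Env k R) L N] (y : Y) : Diamond k R L N →ₗ[L] Diamond k R Y N :=
  L.diamondMap (LinearMap.toSpanSingleton L Y y) LinearMap.id

/-- The `L`-linear maps `φ : L ⋄ N → P`. They carry the `L`-action `(ℓ φ)(x ⊗ n) = φ(x ℓ ⊗ n)`. -/
def InnerHom (N P : Type*) [AddCommGroup N] [Module (Env k R) N] [Module L N]
    [IsScalarTower (Env k R) L N] [AddCommGroup P] [Module L P] : Type _ :=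
  Diamond k R L N →ₗ[L] P

section InnerHom

variable {Y N P : Type*} [AddCommGroup Y] [Module (Env k R) Y] [Module L Y]
  [IsScalarTower (Env k R) L Y] [AddCommGroup N] [Module (Env k R) N] [Module L N]
  [IsScalarTower (Env k R) L N] [AddCommGroup P] [Module L P]

instance : AddCommGroup (L.InnerHom N P) :=
  inferInstanceAs (AddCommGroup (Diamond k R L N →ₗ[L] P))

variable (N P) in
/-- The elements of `InnerHom` as linear maps. -/
def innerHomEquiv : L.InnerHom N P ≃+ (Diamond k R L N →ₗ[L] P) := AddEquiv.refl _

variable {L} in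
lemma innerHom_ext {φ ψ : L.InnerHom N P}
    (h : ∀ x n, L.innerHomEquiv N P φ (Diamond.mk k R x n) =
      L.innerHomEquiv N P ψ (Diamond.mk k R x n)) : φ = ψ :=
  diamondHom_ext h

instance : Module L (L.InnerHom N P) where
  smul x φ := (L.innerHomEquiv N P).symm (L.innerHomEquiv N P φ ∘ₗ L.actLeft x)
  one_smul φ := innerHom_ext fun y n => by
    change L.innerHomEquiv N P φ (Diamond.mk k R (y * 1) n) = _
    rw [mul_one]
  mul_smul x x' φ := innerHom_ext fun y n => by
    change L.innerHomEquiv N P φ (Diamond.mk k R (y * (x * x')) n) =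
      L.innerHomEquiv N P φ (Diamond.mk k R (y * x * x') n)
    rw [mul_assoc]
  smul_zero _ := rfl
  smul_add _ _ _ := rfl
  add_smul x x' φ := innerHom_ext fun y n => by
    change L.innerHomEquiv N P φ (Diamond.mk k R (y * (x + x')) n) =
      L.innerHomEquiv N P φ (Diamond.mk k R (y * x) n) +
        L.innerHomEquiv N P φ (Diamond.mk k R (y * x') n)
    rw [mul_add, map_add, AddMonoidHom.add_apply, map_add]
  zero_smul φ := innerHom_ext fun y n => by
    change L.innerHomEquiv N P φ (Diamond.mk k R (y * 0) n) = 0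
    rw [mul_zero, map_zero, AddMonoidHom.zero_apply, map_zero]

lemma innerHomEquiv_smul_mk (x : L) (φ : L.InnerHom N P) (y : L) (n : N) :
    L.innerHomEquiv N P (x • φ) (Diamond.mk k R y n) =
      L.innerHomEquiv N P φ (Diamond.mk k R (y * x) n) := rfl

/-- Currying `g : Y ⋄ N → P` to `y ↦ (x ⊗ n ↦ g(x y ⊗ n))`. -/
def curry (g : Diamond k R Y N →ₗ[L] P) : Y →ₗ[L] L.InnerHom N P where
  toFun y := (L.innerHomEquiv N P).symm (g ∘ₗ L.actLeft y)
  map_add' y y' := innerHom_ext fun x n => by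
    change g (Diamond.mk k R (x • (y + y')) n) =
      g (Diamond.mk k R (x • y) n) + g (Diamond.mk k R (x • y') n)
    rw [← map_add, ← AddMonoidHom.add_apply, ← map_add, ← smul_add]
  map_smul' x' y := innerHom_ext fun x n => by
    change g (Diamond.mk k R (x • x' • y) n) = g (Diamond.mk k R ((x * x') • y) n)
    rw [mul_smul]

lemma curry_apply (g : Diamond k R Y N →ₗ[L] P) (y : Y) (x : L) (n : N) :
    L.innerHomEquiv N P (L.curry g y) (Diamond.mk k R x n) = g (Diamond.mk k R (x • y) n) := rfl

lemma curry_injective :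
    Function.Injective (L.curry : (Diamond k R Y N →ₗ[L] P) → (Y →ₗ[L] L.InnerHom N P)) :=
  fun g g' h => diamondHom_ext fun y n => by
    rw [← one_smul L y, ← curry_apply, ← curry_apply, h]

/-- Uncurrying `h : Y → InnerHom N P` to `y ⊗ n ↦ h(y)(1 ⊗ n)`. -/
def uncurry (h : Y →ₗ[L] L.InnerHom N P) : Diamond k R Y N →ₗ[L] P :=
  have key : ∀ (x : L) y n, L.innerHomEquiv N P (h (x • y)) (Diamond.mk k R (1 : L) n) =
      L.innerHomEquiv N P (h y) (Diamond.mk k R x n) := fun x y n => by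
    rw [map_smul, innerHomEquiv_smul_mk, one_mul]
  L.diamondHomMk (Diamond.lift
    (AddMonoidHom.mk' (fun y =>
        (L.innerHomEquiv N P (h y)).toAddMonoidHom.comp (Diamond.mk k R (1 : L)))
      fun y y' => by
        rw [map_add, map_add]
        rfl)
    fun r y n => by
      change L.innerHomEquiv N P (h (bar k r • y)) (Diamond.mk k R (1 : L) n) =
        L.innerHomEquiv N P (h y) (Diamond.mk k R (1 : L) (inc k r • n))
      rw [← Diamond.mk_bar, ← L.toEnvRing.unit_smul (bar k r) y, key, EnvRing.smul_eq, mul_one])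
    fun x y n => by
      rw [Diamond.lift_mk]
      change _ = x • L.innerHomEquiv N P (h y) (Diamond.mk k R (1 : L) n)
      rw [← map_smul, PreTakeuchiBialgebra.smul_mk]
      generalize (L.comul x : Diamond k R L L) = D
      induction D using Diamond.induction with
      | h0 => simp only [map_zero, AddMonoidHom.zero_apply]
      | hadd s t hs ht => simp only [map_add, AddMonoidHom.add_apply, hs, ht]
      | hmk z w =>
        rw [EnvRing.act_mk, EnvRing.act_mk, smul_eq_mul, mul_one]
        exact key z y (w • n)

end InnerHom

end TakeuchiBialgebra

end Currying

/-! ### The Hopf property in terms of the underlying functor -/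

section HopfFunctorForget

variable {k : Type v} [CommRing k] {R : Type u} [Ring R] [Algebra k R]

namespace TakeuchiBialgebra

open MonoidalCategory Functor.LaxMonoidal

variable (L : TakeuchiBialgebra k R)

/-- A morphism `Y ⋄ N ⟶ P` as a linear map. -/
def ofTensor {Y N P : L.Rep} (g : Y ⊗ N ⟶ P) :
    Diamond k R (L.forget.obj Y) (L.forget.obj N) →ₗ[L] P := g.hom

lemma whiskerRight_μ_map_mk {X : BimodCat k R} {Y N P : L.Rep} (η : X ⟶ L.forget.obj Y)
    (g : Y ⊗ N ⟶ P) (x : X) (n : L.forget.obj N) :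
    ((η ▷ L.forget.obj N ≫ μ L.forget Y N) ≫ L.forget.map g).hom (Diamond.mk k R x n) =
      L.ofTensor g (Diamond.mk k R (η.hom x) n) := rfl

variable {L}

/-- With unique extensions, an `R ⊗ R̄`-linear map `X ⋄ N → P` amounts to an `R ⊗ R̄`-linear map
`X → InnerHom N P`. -/
lemma HasUniqueExtensions.exists_curry {X : BimodCat k R} {N P : L.Rep}
    (h : L.HasUniqueExtensions (L.forget.obj N)) (f : X ⊗ L.forget.obj N ⟶ L.forget.obj P) :
    ∃ f' : X ⟶ L.forget.obj (ModuleCat.of L (L.InnerHom (L.forget.obj N) P)), ∀ x n,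
      L.innerHomEquiv (L.forget.obj N) P (f'.hom x) (Diamond.mk k R (1 : L) n) =
        f.hom (Diamond.mk k R x n) := by
  have hex : ∀ x : X, ∃ φ : Diamond k R L (L.forget.obj N) →ₗ[L] P,
      ∀ n, φ (Diamond.mk k R (1 : L) n) = f.hom (Diamond.mk k R x n) := fun x =>
    (h P (f.hom.toAddMonoidHom.comp (Diamond.mk k R x)) fun r n => by
      change f.hom (Diamond.mk k R x (bar k r • n)) = bar k r • f.hom (Diamond.mk k R x n)
      rw [← map_smul, Diamond.bar_smul_mk]).exists
  choose Φ hΦ using hex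
  let Ψ : X →+ L.InnerHom (L.forget.obj N) P := AddMonoidHom.mk'
    (fun x => (L.innerHomEquiv (L.forget.obj N) P).symm (Φ x)) fun x x' => h.hom_ext fun n => by
      change Φ (x + x') _ = Φ x _ + Φ x' _
      rw [hΦ, hΦ, hΦ, map_add, AddMonoidHom.add_apply, map_add]
      rfl
  -- By uniqueness of extensions, the maps `Φ x` depend `R ⊗ R̄`-linearly on `x`.
  let W : BimodCat k R := L.forget.obj (ModuleCat.of L (L.InnerHom (L.forget.obj N) P))
  let Ψ' : X →+ W := Ψ
  refine ⟨ModuleCat.ofHom (Y := W) (linOf k Ψ' (fun r x => ?_) fun r x => ?_), fun x n => hΦ x n⟩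
  · refine h.hom_ext fun n => ?_
    change Φ (inc k r • x) (Diamond.mk k R (1 : L) n) =
      Φ x (Diamond.mk k R (1 * L.toEnvRing.unit (inc k r)) n)
    have hinc : Φ x (Diamond.mk k R (1 * L.toEnvRing.unit (inc k r)) n) =
        L.toEnvRing.unit (inc k r) • Φ x (Diamond.mk k R (1 : L) n) := by
      rw [one_mul, ← mul_one (L.toEnvRing.unit _), ← EnvRing.smul_eq, ← L.unit_inc_smul_mk,
        map_smul, EnvRing.smul_eq, mul_one]
    refine (hΦ _ n).trans (Eq.trans ?_ (hinc.trans (congrArg _ (hΦ x n))).symm)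
    exact (congrArg f.hom (Diamond.inc_smul_mk r x n).symm).trans (map_smul f.hom (inc k r) _)
  · refine h.hom_ext fun n => ?_
    change Φ (bar k r • x) (Diamond.mk k R (1 : L) n) =
      Φ x (Diamond.mk k R (1 * L.toEnvRing.unit (bar k r)) n)
    refine (hΦ _ n).trans (((congrArg f.hom (Diamond.mk_bar r x n)).trans
      (hΦ x _).symm).trans (congrArg (Φ x) ?_))
    rw [one_mul, ← mul_one (L.toEnvRing.unit _), ← EnvRing.smul_eq, Diamond.mk_bar]

/-- Unique extensions identify `R ⊗ R̄`-linear maps `X ⋄ N → P` with `R ⊗ R̄`-linear maps from `X`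
to `InnerHom N P`, hence, if `Y` is free on `X`, with `L`-linear maps `Y → InnerHom N P`, and these
with `L`-linear maps `Y ⋄ N → P`. -/
lemma HasUniqueExtensions.isHopfFunctor (h : L.HasUniqueExtensions L) :
    IsHopfFunctor L.forget := by
  intro X Y η N hη P
  have hN : L.HasUniqueExtensions (L.forget.obj N) := h.of_self
  constructor
  · intro g g' hg
    -- The curried maps agree on the image of `η`, since they agree there on all `1 ⊗ n`.
    have hc : (ModuleCat.ofHom (L.curry (Y := L.forget.obj Y) (L.ofTensor g)) :
        Y ⟶ ModuleCat.of L (L.InnerHom (L.forget.obj N) P)) =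
        ModuleCat.ofHom (L.curry (Y := L.forget.obj Y) (L.ofTensor g')) :=
      (hη _).1 (ModuleCat.hom_ext (LinearMap.ext fun x => hN.hom_ext fun n => by
        change L.innerHomEquiv (L.forget.obj N) P
            (L.curry (Y := L.forget.obj Y) (L.ofTensor g) (η.hom x)) (Diamond.mk k R (1 : L) n) =
          L.innerHomEquiv (L.forget.obj N) P
            (L.curry (Y := L.forget.obj Y) (L.ofTensor g') (η.hom x)) (Diamond.mk k R (1 : L) n)
        rw [curry_apply, curry_apply, one_smul, ← whiskerRight_μ_map_mk, ← whiskerRight_μ_map_mk]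
        exact congrArg (fun φ => φ.hom (Diamond.mk k R x n)) hg))
    exact ModuleCat.hom_ext (L.curry_injective (congrArg ModuleCat.Hom.hom hc))
  · intro f
    obtain ⟨f', hf'⟩ := hN.exists_curry f
    obtain ⟨g, rfl⟩ := (hη _).2 f'
    refine ⟨ModuleCat.ofHom (Y := P) (L.uncurry (Y := L.forget.obj Y) g.hom),
      BimodCat.hom_ext k R fun x n => ?_⟩
    rw [← hf']
    rfl

/-- The map `x ⊗ n ↦ r f(s n)`, for `x = r s̄`, as a morphism `(R ⊗ R̄) ⋄ N ⟶ P`. It is an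
extension of `f` along `n ↦ 1 ⊗ n`. -/
lemma exists_env_diamond_hom {N P : BimodCat k R} (f : N →+ P)
    (hf : ∀ (r : R) n, f (bar k r • n) = bar k r • f n) :
    ∃ g : ModuleCat.of (Env k R) (Env k R) ⊗ N ⟶ P,
      ∀ n, g.hom (Diamond.mk k R (1 : Env k R) n) = f n := by
  let ψ : R →+ Rᵐᵒᵖ →+ N →+ P := AddMonoidHom.mk' (fun r => AddMonoidHom.mk'
      (fun s => (DistribSMul.toAddMonoidHom P (inc k r)).comp
        (f.comp (DistribSMul.toAddMonoidHom N (inc k s.unop)))) fun s s' => by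
      ext n
      change inc k r • f (inc k (s + s').unop • n) =
        inc k r • f (inc k s.unop • n) + inc k r • f (inc k s'.unop • n)
      rw [show (s + s').unop = s.unop + s'.unop from rfl, inc_add, add_smul, map_add,
        smul_add]) fun r r' => by
    refine AddMonoidHom.ext fun s => AddMonoidHom.ext fun n => ?_
    change inc k (r + r') • f (inc k s.unop • n) =
      inc k r • f (inc k s.unop • n) + inc k r' • f (inc k s.unop • n)
    rw [inc_add, add_smul]
  let Ψ : Env k R →+ N →+ P := TensorProduct.liftAddHom ψ fun c r s => by
    ext n
    change inc k (c • r) • f (inc k s.unop • n) = inc k r • f (inc k (c • s).unop • n)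
    rw [unop_smul, Algebra.smul_def, Algebra.smul_def, Algebra.commutes c r, inc_mul, inc_mul,
      mul_smul, mul_smul, ← algebraMap_eq_inc, algebraMap_eq_bar, hf]
  have hΨ : ∀ (r : R) (s : Rᵐᵒᵖ) n, Ψ (r ⊗ₜ s) n = inc k r • f (inc k s.unop • n) :=
    fun _ _ _ => rfl
  refine ⟨ModuleCat.ofHom (Diamond.liftLin Ψ (fun t a n => ?_) (fun t a n => ?_) fun t a n => ?_),
    fun n => ?_⟩
  · induction a using TensorProduct.induction_on with
    | zero => rw [smul_zero, map_zero, AddMonoidHom.zero_apply, AddMonoidHom.zero_apply]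
    | add x y hx hy => rw [smul_add, map_add, map_add, AddMonoidHom.add_apply,
        AddMonoidHom.add_apply, hx, hy]
    | tmul r s =>
      rw [smul_eq_mul, bar, Algebra.TensorProduct.tmul_mul_tmul, one_mul, hΨ, hΨ, unop_mul,
        unop_op, inc_mul, mul_smul]
  · induction a using TensorProduct.induction_on with
    | zero => rw [smul_zero, map_zero, AddMonoidHom.zero_apply, smul_zero]
    | add x y hx hy => rw [smul_add, map_add, map_add, AddMonoidHom.add_apply,
        AddMonoidHom.add_apply, hx, hy, smul_add]
    | tmul r s =>
      rw [smul_eq_mul, inc, Algebra.TensorProduct.tmul_mul_tmul, one_mul, hΨ, hΨ, inc_mul, mul_smul]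
      rfl
  · induction a using TensorProduct.induction_on with
    | zero => rw [map_zero, AddMonoidHom.zero_apply, AddMonoidHom.zero_apply, smul_zero]
    | add x y hx hy => rw [map_add, AddMonoidHom.add_apply,
        AddMonoidHom.add_apply, hx, hy, smul_add]
    | tmul r s =>
      rw [hΨ, hΨ, ← mul_smul (inc k s.unop), ← bar_mul_inc, mul_smul, hf, ← mul_smul, ← mul_smul,
        bar_mul_inc]
  · change inc k (1 : R) • f (inc k (1 : R) • n) = f n
    rw [inc_one, one_smul, one_smul]

lemma env_diamond_hom_ext {N P : BimodCat k R} {g g' : ModuleCat.of (Env k R) (Env k R) ⊗ N ⟶ P}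
    (h : ∀ n, g.hom (Diamond.mk k R (1 : Env k R) n) = g'.hom (Diamond.mk k R (1 : Env k R) n)) :
    g = g' := by
  refine ModuleCat.hom_ext (Diamond.lin_ext (M := Env k R) fun a n => ?_)
  induction a using TensorProduct.induction_on with
  | zero => rw [map_zero, AddMonoidHom.zero_apply, map_zero, map_zero]
  | add x y hx hy => rw [map_add, AddMonoidHom.add_apply, map_add, map_add, hx, hy]
  | tmul r s =>
    have hrs : r ⊗ₜ[k] s = inc k r • bar k s.unop • (1 : Env k R) := by
      rw [smul_eq_mul, smul_eq_mul, mul_one, inc_mul_bar]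
    rw [hrs, ← Diamond.inc_smul_mk, Diamond.mk_bar]
    exact (map_smul g.hom (inc k r) _).trans
      ((congrArg (inc k r • ·) (h _)).trans (map_smul g'.hom (inc k r) _).symm)

variable (L) in
/-- `R ⊗ R̄ → L` as a morphism to the underlying module of the regular `L`-module. -/
def unitHom : ModuleCat.of (Env k R) (Env k R) ⟶ L.forget.obj (ModuleCat.of L L) :=
  ModuleCat.ofHom (Y := L.forget.obj (ModuleCat.of L L))
    { toFun := fun a => L.toEnvRing.unit a
      map_add' := map_add L.toEnvRing.unit
      map_smul' := map_mul L.toEnvRing.unit }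

lemma unitHom_one : L.unitHom.hom (1 : Env k R) = (1 : L) := map_one L.toEnvRing.unit

/-- The regular `L`-module is free on the regular `R ⊗ R̄`-module. -/
lemma isUniversalArrow_unitHom : IsUniversalArrow L.forget L.unitHom := by
  intro P
  have key : ∀ g : ModuleCat.of L L ⟶ P,
      (L.unitHom ≫ L.forget.map g).hom (1 : Env k R) = g.hom (1 : L) := fun g =>
    congrArg g.hom (map_one L.toEnvRing.unit)
  refine ⟨fun g g' h => ModuleCat.hom_ext (LinearMap.ext_ring ?_), fun f =>
    ⟨ModuleCat.ofHom (LinearMap.toSpanSingleton L P (f.hom (1 : Env k R))),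
      ModuleCat.hom_ext (LinearMap.ext_ring ?_)⟩⟩
  · rw [← key, ← key]
    exact congrArg (fun f => f.hom (1 : Env k R)) h
  · refine (key _).trans ?_
    exact one_smul L _

/-- Combines the universal property of `(R ⊗ R̄) ⋄ N` with the one that `L ⋄ N` has over it. -/
lemma existsUnique_of_isHopfFunctor (h : IsHopfFunctor L.forget) {N P : L.Rep}
    (f : L.forget.obj N →+ L.forget.obj P) (hf : ∀ (r : R) n, f (bar k r • n) = bar k r • f n) :
    ∃! g : ModuleCat.of L L ⊗ N ⟶ P,
      ∀ n, L.ofTensor g (Diamond.mk k R (1 : L) n) = f n := by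
  have hu := h L.unitHom N isUniversalArrow_unitHom P
  have key : ∀ (g : ModuleCat.of L L ⊗ N ⟶ P) (n : L.forget.obj N),
      L.ofTensor g (Diamond.mk k R (1 : L) n) =
      ((L.unitHom ▷ L.forget.obj N ≫ μ L.forget (ModuleCat.of L L) N) ≫ L.forget.map g).hom
          (Diamond.mk k R (1 : Env k R) n) := fun g n =>
    ((L.whiskerRight_μ_map_mk L.unitHom g (1 : Env k R) n).trans
      (congrArg (fun x : L => L.ofTensor g (Diamond.mk k R x n)) unitHom_one)).symm
  obtain ⟨F, hF⟩ := exists_env_diamond_hom f hf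
  obtain ⟨g, hg⟩ := hu.2 F
  have hg' : ∀ n, L.ofTensor g (Diamond.mk k R (1 : L) n) = f n := fun n =>
    (key g n).trans ((congrArg (fun φ => φ.hom (Diamond.mk k R (1 : Env k R) n)) hg).trans (hF n))
  exact ⟨g, hg', fun g' hg'' => hu.1 (env_diamond_hom_ext fun n =>
    (key g' n).symm.trans ((hg'' n).trans ((hg' n).symm.trans (key g n))))⟩

/-- The universal arrow `R ⊗ R̄ → L`, tensored with `L`, shows that `L ⋄ L` is free on
`(R ⊗ R̄) ⋄ L`, which has the universal property of the `R ⊗ R̄`-module induced from the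
`R̄`-module `L`. -/
lemma hasUniqueExtensions_of_isHopfFunctor (h : IsHopfFunctor L.forget) :
    L.HasUniqueExtensions L := by
  intro P _ _ f hf
  obtain ⟨g, hg, hg'⟩ := existsUnique_of_isHopfFunctor h (N := ModuleCat.of L L)
    (P := ModuleCat.of L P) f hf
  exact ⟨L.ofTensor g, hg, fun ψ hψ => congrArg L.ofTensor (hg' (ModuleCat.ofHom ψ) hψ)⟩

/-- Bijectivity of the Galois map is a property of the monoidal functor `L.forget` alone. -/
theorem isHopf_iff_isHopfFunctor : L.IsHopf ↔ IsHopfFunctor L.forget :=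
  L.isHopf_iff_hasUniqueExtensions.trans
    ⟨HasUniqueExtensions.isHopfFunctor, hasUniqueExtensions_of_isHopfFunctor⟩

end TakeuchiBialgebra

end HopfFunctorForget

end QuantumGroupoid

end

theorem mainTheorem2 {k : Type v} [CommRing k] {R S : Type u} [Ring R] [Algebra k R]
    [Ring S] [Algebra k S]
    (F : QuantumGroupoid.BimodCat k R ⥤ QuantumGroupoid.BimodCat k S) [F.Monoidal]
    (hF : QuantumGroupoid.IsSqmEquivalence F)
    (L : QuantumGroupoid.TakeuchiBialgebra k R) (L' : QuantumGroupoid.TakeuchiBialgebra k S)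
    (hL : QuantumGroupoid.IsBaseChange F L L') :
    L'.IsHopf ↔ L.IsHopf := by
  obtain ⟨G, _, e, _, _⟩ := hL
  have := hF.isEquivalence
  rw [QuantumGroupoid.TakeuchiBialgebra.isHopf_iff_isHopfFunctor,
    QuantumGroupoid.TakeuchiBialgebra.isHopf_iff_isHopfFunctor]
  exact QuantumGroupoid.isHopfFunctor_iff e
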